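/- Let $\Omega=(-\pi,\pi)^2$ and call a function on $\mathbb R^2$ periodic if it is $2\pi$-periodic in each variable; elements of $L^2(\Omega)$ are identified with their periodic extensions. Let $w$ be a nonnegative radial kernel supported on the unit ball of $\mathbb R^2$, positive almost everywhere there, with $\int_{\mathbb R^2}w(|x|)\,|x|\,dx=2$, and put $w_\delta(r)=\delta^{-3}w(r/\delta)$ for $\delta>0$. Let $\vec n\in\mathbb R^2$ be a unit vector and $\chi_{\vec n}$ the characteristic function of $\{z: z\cdot\vec n\ge 0\}$. For smooth periodic $\varphi$ (scalar) and $\mathbf v$ ($\mathbb R^2$-valued) set $$\mathcal G_\delta^{\vec n}\varphi(x)=2\int_{\mathbb R^2}\chi_{\vec n}(y-x)\,w_\delta(|y-x|)\,(y-x)\,\frac{\varphi(y)-\varphi(x)}{|y-x|}\,dy,\qquad \mathcal D_\delta^{\vec n}\mathbf v(x)=2\int_{\mathbb R^2}\chi_{\vec n}(s)\,\frac{w_\delta(|s|)}{|s|}\,s\cdot(\mathbf v(x)-\mathbf v(x-s))\,ds,$$ and let $(\mathcal G_\delta^{\vec n}\mathbf v)_{ij}=(\mathcal G_\delta^{\vec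 n}v_j)_i$ and $e_\delta^{\vec n}(\mathbf v)=\frac12\big(\mathcal G_\delta^{\vec n}\mathbf v+(\mathcal G_\delta^{\vec n}\mathbf v)^T\big)$. Let $\mu>0$, $\lambda+2\mu>0$, and define $$P_\delta^{\vec n}\mathbf v=-\mu\,\mathcal D_\delta^{\vec n}\mathcal G_\delta^{\vec n}\mathbf v-(\lambda+\mu)\,\mathcal G_\delta^{\vec n}\mathcal D_\delta^{\vec n}\mathbf v,\qquad P_0\mathbf v=-\mu\Delta\mathbf v-(\lambda+\mu)\nabla\nabla\cdot\mathbf v,$$ where in the first term $\mathcal D_\delta^{\vec n}\mathcal G_\delta^{\vec n}$ acts on each component of $\mathbf v$. Let $\mathcal E_\delta^{\vec n}(\mathbf v)=\frac\lambda2\|\mathcal D_\delta^{\vec n}\mathbf v\|_{L^2(\Omega)}^2+\mu\|e_\delta^{\vec n}(\mathbf v)\|_{L^2(\Omega)}^2$. The space $V_\delta^{\vec n}$ is the closure of the smooth periodic zero-mean vector fields in the norm $\|\mathbf v\|_{V_\delta^{\vec n}}=(\|\mathbf v\|_{L^2}^2+\mathcal E_\delta^{\vec n}(\mathbf v))^{1/2}$,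 and $V_0$ is the space of periodic zero-mean $H^1$ vector fields with norm $(\|\mathbf v\|_{L^2}^2+\|\nabla\mathbf v\|_{L^2}^2)^{1/2}$. Let $T>0$, let $\mathbf g\in V_0$, let $\mathbf h\in L^2(\Omega;\mathbb R^2)$ have zero mean, and let $\mathbf f\in L^2(0,T;L^2(\Omega;\mathbb R^2))$. For $V=V_0$, $P=P_0$, or $V=V_\delta^{\vec n}$, $P=P_\delta^{\vec n}$, a solution of $\mathbf u_{tt}+P\mathbf u=\mathbf f$, $\mathbf u|_{t=0}=\mathbf g$, $\mathbf u_t|_{t=0}=\mathbf h$ means a function $\mathbf u\in C([0,T];V)$ with $\mathbf u_t\in L^2(0,T;L^2(\Omega))$ and $\mathbf u(0)=\mathbf g$ such that, for every smooth periodic zero-mean vector field $\varphi$ and almost every $t\in(0,T)$, $$(\mathbf u_t(t),\varphi)=(\mathbf h,\varphi)+\int_0^t\big[(\mathbf f(s),\varphi)-(\mathbf u(s),P\varphi)\big]\,ds,$$ where $(\cdot,\cdot)$ is the inner product of $L^2(\Omega;\mathbb R^2)$. Let $\mathbf u$ be the solution of the local equation ($V=V_0$, $P=P_0$) and, for small $\delta>0$,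 let $\mathbf u_\delta^{\vec n}$ be the solution of the nonlocal equation ($V=V_\delta^{\vec n}$, $P=P_\delta^{\vec n}$), with the same data $\mathbf g,\mathbf h,\mathbf f$. Then $\mathbf u_\delta^{\vec n}\to\mathbf u$ in $L^2(0,T;V_\delta^{\vec n})\cap H^1(0,T;L^2(\Omega))$ as $\delta\to0$, that is, $$\int_0^T\|\mathbf u_\delta^{\vec n}(t)-\mathbf u(t)\|_{V_\delta^{\vec n}}^2\,dt\to0\quad\text{and}\quad\int_0^T\Big(\|\mathbf u_\delta^{\vec n}(t)-\mathbf u(t)\|_{L^2}^2+\|(\mathbf u_\delta^{\vec n})_t(t)-\mathbf u_t(t)\|_{L^2}^2\Big)\,dt\to0 .$$ -/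

import Mathlib

open MeasureTheory Filter Topology
open scoped ENNReal ContDiff

noncomputable section

namespace NonlocalNavier

/-- The plane `ℝ²` with its Euclidean norm. -/
abbrev Plane : Type := EuclideanSpace ℝ (Fin 2)

/-- The periodic cell `Ω = (-π, π)²`. -/
def cell : Set Plane := {x | ∀ i, x i ∈ Set.Ioo (-Real.pi) Real.pi}

/-- `L²(Ω; ℝ²)`. An element is identified with its `2π`-periodic extension to the plane. -/
abbrev L2 : Type := Lp Plane 2 (volume.restrict cell)

/-- `2π`-periodicity in each of the two variables. -/
def IsPeriodic {α : Type} (φ : Plane → α) : Prop :=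
  ∀ (x : Plane) (i : Fin 2), φ (x + EuclideanSpace.single i (2 * Real.pi)) = φ x

/-- Smooth, periodic vector fields on the plane with zero mean over the cell. -/
structure IsTestField (φ : Plane → Plane) : Prop where
  smooth : ContDiff ℝ ∞ φ
  periodic : IsPeriodic φ
  mean_zero : ∫ x in cell, φ x = 0

/-- The pairing `∫_Ω u · φ`. -/
def pairing (u : L2) (φ : Plane → Plane) : ℝ := ∫ x in cell, inner ℝ (u x) (φ x)

/-! ### Kernels and nonlocal operators -/

/-- Admissible radial profiles `w` in dimension `d = 2`: nonnegative, supported on the unit ball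
and positive almost everywhere there, with first moment `∫ w(|x|) |x| dx = d = 2`. -/
structure IsKernel (w : ℝ → ℝ) : Prop where
  nonneg : ∀ r, 0 < r → 0 ≤ w r
  support : ∀ r, 1 < r → w r = 0
  pos : ∀ᵐ r ∂(volume.restrict (Set.Ioo (0 : ℝ) 1)), 0 < w r
  integrable : Integrable (fun x : Plane => w ‖x‖ * ‖x‖)
  moment : ∫ x : Plane, w ‖x‖ * ‖x‖ = 2

/-- The rescaled kernel `w_δ(r) = δ^{-(d+1)} w(r / δ)` with `d = 2`. -/
def scaledKernel (w : ℝ → ℝ) (δ r : ℝ) : ℝ := 1 / δ ^ 3 * w (r / δ)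

open Classical in
/-- The characteristic function `χ_n` of the half-plane `{z | z · n ≥ 0}`. -/
def halfPlane (n z : Plane) : ℝ := if 0 ≤ inner ℝ z n then 1 else 0

/-- The nonlocal gradient of a scalar function:
`2 ∫ χ_n(y - x) w_δ(|y - x|) (y - x) (φ(y) - φ(x)) / |y - x| dy`. -/
def nonlocalGrad (w : ℝ → ℝ) (n : Plane) (δ : ℝ) (φ : Plane → ℝ) (x : Plane) : Plane :=
  (2 : ℝ) • ∫ y : Plane,
    (halfPlane n (y - x) * scaledKernel w δ ‖y - x‖ * ((φ y - φ x) / ‖y - x‖)) • (y - x)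

/-- The nonlocal divergence of a vector field:
`2 ∫ χ_n(s) w_δ(|s|) / |s| s · (v(x) - v(x - s)) ds`. -/
def nonlocalDiv (w : ℝ → ℝ) (n : Plane) (δ : ℝ) (v : Plane → Plane) (x : Plane) : ℝ :=
  2 * ∫ s : Plane,
    halfPlane n s * (scaledKernel w δ ‖s‖ / ‖s‖) * inner ℝ s (v x - v (x - s))

/-- The local divergence. -/
def localDiv (v : Plane → Plane) (x : Plane) : ℝ :=
  ∑ i : Fin 2, fderiv ℝ v x (EuclideanSpace.single i 1) i

/-- The Navier operator `-μ D(G v) - (λ + μ) G(D v)` built from a gradient `G` and a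
divergence `D`; in the first term `D ∘ G` acts on each component of `v`. -/
def navier (G : (Plane → ℝ) → Plane → Plane) (D : (Plane → Plane) → Plane → ℝ)
    (lam mu : ℝ) (v : Plane → Plane) (x : Plane) : Plane :=
  WithLp.toLp 2 fun j : Fin 2 =>
    -mu * D (G fun y => v y j) x - (lam + mu) * G (D v) x j

/-- The nonlocal Navier operator on smooth fields. -/
def nonlocalNavier (w : ℝ → ℝ) (n : Plane) (δ lam mu : ℝ) :
    (Plane → Plane) → Plane → Plane :=
  navier (nonlocalGrad w n δ) (nonlocalDiv w n δ) lam mu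

/-- The local Navier operator `-μ Δ v - (λ + μ) ∇ (∇ · v)` on smooth fields. -/
def localNavier (lam mu : ℝ) : (Plane → Plane) → Plane → Plane :=
  navier gradient localDiv lam mu

/-! ### The nonlocal energy space -/

/-- The `(i, j)` entry of the nonlocal strain tensor `(G v + (G v)ᵀ) / 2`, where
`(G v)_{i j}` is the `i`-th component of the nonlocal gradient of `v_j`. -/
def strain (w : ℝ → ℝ) (n : Plane) (δ : ℝ) (v : Plane → Plane) (x : Plane) (i j : Fin 2) : ℝ :=
  (nonlocalGrad w n δ (fun y => v y j) x i + nonlocalGrad w n δ (fun y => v y i) x j) / 2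

/-- The nonlocal elastic energy `(λ / 2) ‖D v‖² + μ ‖e(v)‖²` of a smooth field. -/
def energy (w : ℝ → ℝ) (n : Plane) (δ lam mu : ℝ) (v : Plane → Plane) : ℝ :=
  1 / 2 * lam * (∫ x in cell, nonlocalDiv w n δ v x ^ 2)
    + mu * ∫ x in cell, ∑ i : Fin 2, ∑ j : Fin 2, strain w n δ v x i j ^ 2

/-- `u` is the `L²` limit of smooth periodic zero-mean fields that form a Cauchy sequence for the
energy, and `e` is the limit of their energies: `u` lies in the closure of these fields for
the norm `(‖·‖² + energy)^{1/2}`, and `e` is the extension of the energy to `u`. -/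
def HasEnergy (w : ℝ → ℝ) (n : Plane) (δ lam mu : ℝ) (u : L2) (e : ℝ) : Prop :=
  ∃ φ : ℕ → Plane → Plane,
    (∀ k, IsTestField (φ k)) ∧
    Tendsto (fun k => eLpNorm (fun x => φ k x - u x) 2 (volume.restrict cell)) atTop (𝓝 0) ∧
    Tendsto (fun p : ℕ × ℕ => energy w n δ lam mu (fun x => φ p.1 x - φ p.2 x)) atTop (𝓝 0) ∧
    Tendsto (fun k => energy w n δ lam mu (φ k)) atTop (𝓝 e)

/-- The nonlocal energy space `V_δ^n`. -/
def nonlocalV (w : ℝ → ℝ) (n : Plane) (δ lam mu : ℝ) : Set L2 :=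
  {u | ∃ e, HasEnergy w n δ lam mu u e}

/-- The squared norm `‖u‖²_{L²} + energy(u)` of `V_δ^n`; it is `∞` outside `V_δ^n`. -/
def nonlocalVNormSq (w : ℝ → ℝ) (n : Plane) (δ lam mu : ℝ) (u : L2) : ℝ≥0∞ :=
  ⨅ (e : ℝ) (_ : HasEnergy w n δ lam mu u e), ENNReal.ofReal (‖u‖ ^ 2 + e)

/-! ### The local energy space -/

/-- `A i` is the weak partial derivative `∂_i u`, tested against smooth periodic functions. -/
def IsWeakGrad (u : L2) (A : Fin 2 → L2) : Prop :=
  ∀ φ : Plane → ℝ, ContDiff ℝ ∞ φ → IsPeriodic φ → ∀ i : Fin 2,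
    ∫ x in cell, fderiv ℝ φ x (EuclideanSpace.single i 1) • u x
      = -∫ x in cell, φ x • A i x

/-- The space `V_0` of periodic zero-mean `H¹` vector fields. -/
def localV : Set L2 := {u | ∫ x in cell, u x = 0 ∧ ∃ A, IsWeakGrad u A}

/-- The squared norm `‖u‖² + ‖∇u‖²` of `V_0`. -/
def localVNormSq (u : L2) : ℝ≥0∞ :=
  ⨅ (A : Fin 2 → L2) (_ : IsWeakGrad u A), ENNReal.ofReal (‖u‖ ^ 2 + ∑ i, ‖A i‖ ^ 2)

/-! ### Weak solutions of the wave-type equation -/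

/-- `u` solves `u_tt + P u = f` on `(0, T) × Ω` with `u(0) = g` and `u_t(0) = h`, in the class
`u ∈ C([0, T]; V)`, `u_t = u' ∈ L²(0, T; L²)`. Here `normSq` is the squared norm of the energy
space `V`, and `P` is a formally self-adjoint operator, so that the equation can be tested
against smooth periodic zero-mean fields `φ` by letting `P` act on `φ`: for each of them
`d/dt (u', φ) + (u, P φ) = (f, φ)` on `(0, T)` and `(u', φ) = (h, φ)` at `t = 0`, which is
written in the form integrated in time. -/
structure IsWeakSolution (V : Set L2) (normSq : L2 → ℝ≥0∞)
    (P : (Plane → Plane) → Plane → Plane) (T : ℝ) (f : ℝ → L2) (g h : L2)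
    (u u' : ℝ → L2) : Prop where
  mem : ∀ t ∈ Set.Icc 0 T, u t ∈ V
  continuous : ∀ t ∈ Set.Icc 0 T,
    Tendsto (fun s => normSq (u s - u t)) (𝓝[Set.Icc 0 T] t) (𝓝 0)
  deriv_memLp : MemLp u' 2 (volume.restrict (Set.Ioo 0 T))
  deriv : ∀ t ∈ Set.Icc 0 T, u t = g + ∫ s in (0 : ℝ)..t, u' s
  equation : ∀ φ : Plane → Plane, IsTestField φ →
    ∀ᵐ t ∂(volume.restrict (Set.Ioo 0 T)),
      pairing (u' t) φ
        = pairing h φ + ∫ s in (0 : ℝ)..t, (pairing (f s) φ - pairing (u s) (P φ))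

end NonlocalNavier

end

/-!
The equation is diagonal in Fourier variables, and the proof reduces it to a family of
second-order linear ordinary differential equations in `ℂ²`, one for each frequency `k ∈ ℤ²`.

The nonlocal gradient multiplies the `k`-th Fourier coefficient by a vector `Λ_δ(k) ∈ ℂ²`
(`nonlocalSymbol`), and the nonlocal divergence is minus its adjoint (`IsKernel.hasSymbol_nonlocal`);
the local gradient has the symbol `i k` (`hasSymbol_local`). Hence the Navier operators multiply by
the symmetric matrices `μ |Λ|² + (λ + μ) Λ Λ*` (`navierSymbol`), which lie between
`min(μ, λ + 2μ) |Λ|²` and a constant times `|Λ|²`, and the nonlocal energy of a field is a sum over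
its modes that is bounded by a constant times `∑ |Λ_δ(k)|² |v̂(k)|²`
(`IsKernel.hasEnergy_of_summable`). Two facts about the symbol are needed, and both come from its
rescaled form `nonlocalSymbol_eq_rescaled`: the bound `|Λ_δ(k)|² ≤ 32 |k|²`, uniform in `δ`
(`IsKernel.norm_sq_nonlocalSymbol_le`), and the limit `Λ_δ(k) → i k`
(`IsKernel.tendsto_nonlocalSymbol`), where the isotropy of `w` and its normalization enter.

Testing a weak solution with `Re(a exp(i k · x))` gives the equation `x'' + M x = F` for its `k`-th
coefficient (`IsWeakSolution.exists_isModeSolution`); for `k = 0` both solutions vanish. The energy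
estimate for this equation (`IsModeSolution.energy_le`) is used twice. Applied to each solution, it
bounds the distance of the nonlocal from the local mode in the energy norm by a summable sequence
in `k` that is independent of `δ` and of the time (`IsModeSolution.norm_sub_sq_le_bound`);
summability rests on `g ∈ H¹`, `h ∈ L²` and `f ∈ L²(0, T; L²)`. Applied to the difference of the two
modes, which solves the nonlocal equation with zero data and the forcing `(M₀ - M_δ) x`, it shows
that this distance tends to zero for each fixed `k` (`IsModeSolution.norm_sub_sq_le_of_operator`).
Dominated convergence over `k` concludes. No compactness argument is needed, and the convergence is
uniform in time.
-/

noncomputable section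

namespace NonlocalNavier

/-! ### Second-order linear equations with integrable forcing -/

section ModeEquation

theorem mul_sub_mul_eq_integral_of_primitive {X Y X' Y' : ℝ → ℝ} {t : ℝ} (ht : 0 ≤ t)
    (hX' : IntervalIntegrable X' volume 0 t) (hY' : IntervalIntegrable Y' volume 0 t)
    (hX : ∀ s ∈ Set.Icc 0 t, X s = X 0 + ∫ r in (0 : ℝ)..s, X' r)
    (hY : ∀ s ∈ Set.Icc 0 t, Y s = Y 0 + ∫ r in (0 : ℝ)..s, Y' r) :
    X t * Y t - X 0 * Y 0 = ∫ s in (0 : ℝ)..t, (X' s * Y s + X s * Y' s) := by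
  have hac : ∀ (Z' : ℝ → ℝ) (c : ℝ), IntervalIntegrable Z' volume 0 t →
      AbsolutelyContinuousOnInterval (fun s => c + ∫ r in (0 : ℝ)..s, Z' r) 0 t := by
    intro Z' c h
    have h1 : AbsolutelyContinuousOnInterval (fun _ : ℝ => c) 0 t :=
      ((LipschitzWith.const c).lipschitzOnWith (s := Set.uIcc 0 t)).absolutelyContinuousOnInterval
    exact h1.add (h.absolutelyContinuousOnInterval_intervalIntegral (by simp))
  have hder : ∀ (Z' : ℝ → ℝ) (c : ℝ), IntervalIntegrable Z' volume 0 t →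
      ∀ᵐ s, s ∈ Set.uIcc 0 t → deriv (fun s => c + ∫ r in (0 : ℝ)..s, Z' r) s = Z' s := by
    intro Z' c h
    filter_upwards [h.ae_hasDerivAt_integral] with s hs hst
    exact ((hs hst 0 (by simp)).const_add c).deriv
  have key := (hac X' (X 0) hX').integral_deriv_mul_eq_sub (hac Y' (Y 0) hY')
  have e1 := hX t ⟨ht, le_rfl⟩
  have e2 := hY t ⟨ht, le_rfl⟩
  rw [e1, e2]
  simp only [intervalIntegral.integral_same, add_zero] at key
  rw [← key]
  apply intervalIntegral.integral_congr_ae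
  filter_upwards [hder X' (X 0) hX', hder Y' (Y 0) hY'] with s h1 h2 hs
  have hs' : s ∈ Set.uIcc 0 t := Set.uIoc_subset_uIcc hs
  rw [h1 hs', h2 hs']
  rw [Set.uIcc_of_le ht] at hs'
  rw [hX s hs', hY s hs']

variable {E : Type*} [NormedAddCommGroup E] [InnerProductSpace ℝ E]

theorem continuousOn_of_eq_add_primitive {X X' : ℝ → E} {t : ℝ} (ht : 0 ≤ t)
    (hX' : IntervalIntegrable X' volume 0 t)
    (hX : ∀ s ∈ Set.Icc 0 t, X s = X 0 + ∫ r in (0 : ℝ)..s, X' r) :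
    ContinuousOn X (Set.Icc 0 t) := by
  have h := intervalIntegral.continuousOn_primitive_interval' (μ := volume) hX'
    (Set.left_mem_uIcc : (0 : ℝ) ∈ Set.uIcc 0 t)
  rw [Set.uIcc_of_le ht] at h
  exact (continuousOn_const.add h).congr hX

/-- The product rule for the inner product of two primitives of integrable functions. The
derivatives exist only almost everywhere, so this rests on absolute continuity. -/
theorem inner_sub_inner_eq_integral_of_primitive [FiniteDimensional ℝ E]
    {X Y X' Y' : ℝ → E} {t : ℝ} (ht : 0 ≤ t)
    (hX' : IntervalIntegrable X' volume 0 t) (hY' : IntervalIntegrable Y' volume 0 t)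
    (hX : ∀ s ∈ Set.Icc 0 t, X s = X 0 + ∫ r in (0 : ℝ)..s, X' r)
    (hY : ∀ s ∈ Set.Icc 0 t, Y s = Y 0 + ∫ r in (0 : ℝ)..s, Y' r) :
    inner ℝ (X t) (Y t) - inner ℝ (X 0) (Y 0)
      = ∫ s in (0 : ℝ)..t, (inner ℝ (X' s) (Y s) + inner ℝ (X s) (Y' s)) := by
  set b := stdOrthonormalBasis ℝ E
  have hexp : ∀ v w : E, inner ℝ v w = ∑ i, inner ℝ (b i) v * inner ℝ (b i) w := by
    intro v w
    rw [← b.sum_inner_mul_inner v w]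
    exact Finset.sum_congr rfl fun i _ => by rw [real_inner_comm]
  have hcoord : ∀ {Z Z' : ℝ → E} (_ : IntervalIntegrable Z' volume 0 t)
      (_ : ∀ s ∈ Set.Icc 0 t, Z s = Z 0 + ∫ r in (0 : ℝ)..s, Z' r) (i),
      IntervalIntegrable (fun s => inner ℝ (b i) (Z' s)) volume 0 t ∧
      ∀ s ∈ Set.Icc 0 t, inner ℝ (b i) (Z s)
        = inner ℝ (b i) (Z 0) + ∫ r in (0 : ℝ)..s, inner ℝ (b i) (Z' r) := by
    intro Z Z' h1 h2 i
    have hint : IntervalIntegrable (fun s => inner ℝ (b i) (Z' s)) volume 0 t :=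
      ⟨(innerSL ℝ (b i)).integrable_comp h1.1, (innerSL ℝ (b i)).integrable_comp h1.2⟩
    refine ⟨hint, fun s hs => ?_⟩
    have hs' : IntervalIntegrable Z' volume 0 s :=
      h1.mono_set <| by
        rw [Set.uIcc_of_le hs.1, Set.uIcc_of_le ht]
        exact Set.Icc_subset_Icc_right hs.2
    have := (innerSL ℝ (b i)).intervalIntegral_comp_comm hs'
    simp only [innerSL_apply_apply] at this
    rw [this, ← inner_add_right, ← h2 s hs]
  have hXc := continuousOn_of_eq_add_primitive ht hX' hX
  have hYc := continuousOn_of_eq_add_primitive ht hY' hY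
  rw [← Set.uIcc_of_le ht] at hXc hYc
  have hsum : ∀ s, inner ℝ (X' s) (Y s) + inner ℝ (X s) (Y' s)
      = ∑ i, (inner ℝ (b i) (X' s) * inner ℝ (b i) (Y s)
        + inner ℝ (b i) (X s) * inner ℝ (b i) (Y' s)) := fun s => by
    rw [hexp (X' s), hexp (X s), Finset.sum_add_distrib]
  rw [funext hsum, hexp (X t), hexp (X 0), ← Finset.sum_sub_distrib]
  rw [intervalIntegral.integral_finsetSum]
  · refine Finset.sum_congr rfl fun i _ => ?_
    obtain ⟨a1, a2⟩ := hcoord hX' hX i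
    obtain ⟨b1, b2⟩ := hcoord hY' hY i
    exact mul_sub_mul_eq_integral_of_primitive ht a1 b1 a2 b2
  · intro i _
    obtain ⟨a1, a2⟩ := hcoord hX' hX i
    obtain ⟨b1, b2⟩ := hcoord hY' hY i
    exact (a1.mul_continuousOn (continuousOn_const.inner hYc)).add
      (b1.continuousOn_mul (continuousOn_const.inner hXc))

/-- The pair `(x, y)` solves `x' = y`, `y' = F - M x` on `[0, T]`, in integrated form. -/
structure IsModeSolution (M : E →L[ℝ] E) (F : ℝ → E) (T : ℝ) (x y : ℝ → E) : Prop where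
  continuousOn : ContinuousOn x (Set.Icc 0 T)
  forcing : IntervalIntegrable F volume 0 T
  position : ∀ t ∈ Set.Icc 0 T, x t = x 0 + ∫ s in (0 : ℝ)..t, y s
  velocity : ∀ t ∈ Set.Icc 0 T, y t = y 0 + ∫ s in (0 : ℝ)..t, (F s - M (x s))

namespace IsModeSolution

variable {M : E →L[ℝ] E} {F x y : ℝ → E} {T : ℝ}

theorem intervalIntegrable_acceleration (h : IsModeSolution M F T x y) (hT : 0 ≤ T) :
    IntervalIntegrable (fun s => F s - M (x s)) volume 0 T := by
  refine h.forcing.sub (ContinuousOn.intervalIntegrable ?_)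
  rw [Set.uIcc_of_le hT]
  exact M.continuous.comp_continuousOn h.continuousOn

theorem continuousOn_velocity (h : IsModeSolution M F T x y) (hT : 0 ≤ T) :
    ContinuousOn y (Set.Icc 0 T) :=
  continuousOn_of_eq_add_primitive hT (h.intervalIntegrable_acceleration hT) h.velocity

/-- Conservation of energy: the elastic term `⟪M x, x⟫` cancels since `M` is symmetric. -/
theorem energy_eq [FiniteDimensional ℝ E] (h : IsModeSolution M F T x y)
    (hsym : ∀ a b, inner ℝ (M a) b = inner ℝ a (M b)) {t : ℝ} (ht : t ∈ Set.Icc 0 T) :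
    ‖y t‖ ^ 2 + inner ℝ (M (x t)) (x t)
      = ‖y 0‖ ^ 2 + inner ℝ (M (x 0)) (x 0) + ∫ s in (0 : ℝ)..t, 2 * inner ℝ (F s) (y s) := by
  have hT : 0 ≤ T := ht.1.trans ht.2
  have hsub : Set.uIcc 0 t ⊆ Set.uIcc 0 T := by
    rw [Set.uIcc_of_le ht.1, Set.uIcc_of_le hT]; exact Set.Icc_subset_Icc_right ht.2
  have hsub' : ∀ s ∈ Set.Icc 0 t, s ∈ Set.Icc 0 T := fun s hs => ⟨hs.1, hs.2.trans ht.2⟩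
  have hyc := h.continuousOn_velocity hT
  have hyi : IntervalIntegrable y volume 0 T :=
    ContinuousOn.intervalIntegrable (by rwa [Set.uIcc_of_le hT])
  have ha := h.intervalIntegrable_acceleration hT
  have e1 := inner_sub_inner_eq_integral_of_primitive ht.1 (ha.mono_set hsub) (ha.mono_set hsub)
    (fun s hs => h.velocity s (hsub' s hs)) (fun s hs => h.velocity s (hsub' s hs))
  have hMy : IntervalIntegrable (fun s => M (y s)) volume 0 T :=
    ContinuousOn.intervalIntegrable
      (by rw [Set.uIcc_of_le hT]; exact M.continuous.comp_continuousOn hyc)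
  have hMx : ∀ s ∈ Set.Icc 0 t, M (x s) = M (x 0) + ∫ r in (0 : ℝ)..s, M (y r) := by
    intro s hs
    have hs2 := hsub' s hs
    rw [M.intervalIntegral_comp_comm (hyi.mono_set (by
      rw [Set.uIcc_of_le hs2.1, Set.uIcc_of_le hT]; exact Set.Icc_subset_Icc_right hs2.2)),
      ← map_add, ← h.position s hs2]
  have e2 := inner_sub_inner_eq_integral_of_primitive ht.1 (hMy.mono_set hsub)
    (hyi.mono_set hsub) hMx (fun s hs => h.position s (hsub' s hs))
  rw [real_inner_self_eq_norm_sq, real_inner_self_eq_norm_sq] at e1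
  have hyc' : ContinuousOn y (Set.uIcc 0 t) := hyc.mono (by rw [Set.uIcc_of_le ht.1]; exact hsub')
  have hxc' : ContinuousOn x (Set.uIcc 0 t) :=
    h.continuousOn.mono (by rw [Set.uIcc_of_le ht.1]; exact hsub')
  have hI2 : IntervalIntegrable
      (fun s => inner ℝ (M (y s)) (x s) + inner ℝ (M (x s)) (y s)) volume 0 t :=
    ContinuousOn.intervalIntegrable
      (((M.continuous.comp_continuousOn hyc').inner hxc').add
        ((M.continuous.comp_continuousOn hxc').inner hyc'))
  have hcong : ∀ s, 2 * inner ℝ (F s) (y s)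
      = (inner ℝ (F s - M (x s)) (y s) + inner ℝ (y s) (F s - M (x s)))
        + (inner ℝ (M (y s)) (x s) + inner ℝ (M (x s)) (y s)) := by
    intro s
    rw [hsym (y s) (x s), real_inner_comm (F s - M (x s)) (y s), inner_sub_left,
      real_inner_comm (M (x s)) (y s)]
    ring
  have hI1 : IntervalIntegrable
      (fun s => inner ℝ (F s - M (x s)) (y s) + inner ℝ (y s) (F s - M (x s))) volume 0 t := by
    have hb : ∀ {Z W : ℝ → E}, IntervalIntegrable Z volume 0 t → ContinuousOn W (Set.uIcc 0 t) →
        IntervalIntegrable (fun s => inner ℝ (Z s) (W s)) volume 0 t := by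
      intro Z W hZ hW
      obtain ⟨C, hC⟩ := isCompact_uIcc.exists_bound_of_continuousOn hW
      rw [intervalIntegrable_iff] at hZ ⊢
      refine (hZ.norm.const_mul C).mono
        (hZ.aestronglyMeasurable.inner
          ((hW.mono Set.uIoc_subset_uIcc).aestronglyMeasurable measurableSet_uIoc)) ?_
      refine (ae_restrict_mem measurableSet_uIoc).mono fun s hs => ?_
      calc ‖inner ℝ (Z s) (W s)‖ ≤ ‖Z s‖ * ‖W s‖ := norm_inner_le_norm _ _
        _ ≤ ‖Z s‖ * C := by gcongr; exact hC s (Set.uIoc_subset_uIcc hs)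
        _ = C * ‖Z s‖ := mul_comm _ _
        _ ≤ ‖C * ‖Z s‖‖ := le_abs_self _
    have h1 := hb (ha.mono_set hsub) hyc'
    refine h1.add ?_
    simpa only [real_inner_comm] using h1
  simp only [hcong]
  rw [intervalIntegral.integral_add hI1 hI2, ← e1, ← e2]
  ring

/-- The energy estimate. Its constants depend neither on `M` nor on `T`, which makes it uniform
over all Fourier modes. -/
theorem energy_le [FiniteDimensional ℝ E] (h : IsModeSolution M F T x y)
    (hsym : ∀ a b, inner ℝ (M a) b = inner ℝ a (M b)) (hpos : ∀ a, 0 ≤ inner ℝ (M a) a)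
    {t : ℝ} (ht : t ∈ Set.Icc 0 T) :
    ‖y t‖ ^ 2 + inner ℝ (M (x t)) (x t)
      ≤ 2 * (‖y 0‖ ^ 2 + inner ℝ (M (x 0)) (x 0)) + 4 * (∫ s in (0 : ℝ)..T, ‖F s‖) ^ 2 := by
  have hT : 0 ≤ T := ht.1.trans ht.2
  have hyc := h.continuousOn_velocity hT
  obtain ⟨τ, hτ, hmax⟩ := isCompact_Icc.exists_isMaxOn ⟨t, ht⟩ hyc.norm
  set S := ‖y τ‖
  set K := ∫ s in (0 : ℝ)..T, ‖F s‖
  have hle : ∀ r ∈ Set.Icc 0 T, ‖y r‖ ^ 2 + inner ℝ (M (x r)) (x r)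
      ≤ ‖y 0‖ ^ 2 + inner ℝ (M (x 0)) (x 0) + 2 * S * K := by
    intro r hr
    rw [h.energy_eq hsym hr]
    have hF : IntervalIntegrable (fun s => 2 * S * ‖F s‖) volume 0 T := h.forcing.norm.const_mul _
    have : ∫ s in (0 : ℝ)..r, 2 * inner ℝ (F s) (y s) ≤ 2 * S * K := by
      calc ∫ s in (0 : ℝ)..r, 2 * inner ℝ (F s) (y s)
          ≤ ‖∫ s in (0 : ℝ)..r, 2 * inner ℝ (F s) (y s)‖ := le_abs_self _
        _ ≤ ∫ s in (0 : ℝ)..r, 2 * S * ‖F s‖ := by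
            refine intervalIntegral.norm_integral_le_of_norm_le hr.1 ?_ (hF.mono_set ?_)
            · refine ae_of_all _ fun s hs => ?_
              rw [norm_mul, Real.norm_two, mul_assoc]
              gcongr
              calc ‖inner ℝ (F s) (y s)‖ ≤ ‖F s‖ * ‖y s‖ := norm_inner_le_norm _ _
                _ ≤ ‖F s‖ * S := by
                  gcongr; exact hmax ⟨hs.1.le, hs.2.trans hr.2⟩
                _ = S * ‖F s‖ := mul_comm _ _
            · rw [Set.uIcc_of_le hr.1, Set.uIcc_of_le hT]; exact Set.Icc_subset_Icc_right hr.2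
        _ ≤ ∫ s in (0 : ℝ)..T, 2 * S * ‖F s‖ :=
            intervalIntegral.integral_mono_interval le_rfl hr.1 hr.2
              (ae_of_all _ fun s => by positivity) hF
        _ = 2 * S * K := by rw [intervalIntegral.integral_const_mul]
    linarith
  have h1 := hle τ hτ
  have h2 := hle t ht
  have h3 := hpos (x τ)
  nlinarith [sq_nonneg (S - 2 * K)]

theorem norm_sq_position_le [FiniteDimensional ℝ E] (h : IsModeSolution M F T x y)
    (hsym : ∀ a b, inner ℝ (M a) b = inner ℝ a (M b)) (hpos : ∀ a, 0 ≤ inner ℝ (M a) a)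
    {t : ℝ} (ht : t ∈ Set.Icc 0 T) :
    ‖x t‖ ^ 2 ≤ 2 * ‖x 0‖ ^ 2 + 2 * T ^ 2 *
      (2 * (‖y 0‖ ^ 2 + inner ℝ (M (x 0)) (x 0)) + 4 * (∫ s in (0 : ℝ)..T, ‖F s‖) ^ 2) := by
  set B := 2 * (‖y 0‖ ^ 2 + inner ℝ (M (x 0)) (x 0)) + 4 * (∫ s in (0 : ℝ)..T, ‖F s‖) ^ 2
  have hB : 0 ≤ B := by have := hpos (x 0); positivity
  have hy : ∀ s ∈ Set.uIoc 0 t, ‖y s‖ ≤ √B := by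
    intro s hs
    rw [Set.uIoc_of_le ht.1] at hs
    have hs' : s ∈ Set.Icc 0 T := ⟨hs.1.le, hs.2.trans ht.2⟩
    apply Real.le_sqrt_of_sq_le
    linarith [h.energy_le hsym hpos hs', hpos (x s)]
  have h1 := intervalIntegral.norm_integral_le_of_norm_le_const hy
  rw [sub_zero, abs_of_nonneg ht.1] at h1
  have h2 : ‖x t‖ ≤ ‖x 0‖ + √B * T := by
    rw [h.position t ht]
    refine (norm_add_le _ _).trans ?_
    have := mul_le_mul_of_nonneg_left ht.2 (Real.sqrt_nonneg B)
    linarith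
  have h3 : (√B * T) ^ 2 = T ^ 2 * B := by rw [mul_pow, Real.sq_sqrt hB]; ring
  have h4 : ‖x t‖ ^ 2 ≤ (‖x 0‖ + √B * T) ^ 2 := by gcongr
  nlinarith [sq_nonneg (‖x 0‖ - √B * T)]

/-- The difference of two solutions with the same forcing and different operators solves the
equation with the commutator `(M - N) x` as forcing. -/
theorem sub {N : E →L[ℝ] E} {x₁ y₁ : ℝ → E} (hT : 0 ≤ T) (h₁ : IsModeSolution N F T x₁ y₁)
    (h : IsModeSolution M F T x y) :
    IsModeSolution N (fun s => (M - N) (x s)) T (fun t => x₁ t - x t) (fun t => y₁ t - y t) := by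
  have hcx : ContinuousOn (fun s => (M - N) (x s)) (Set.Icc 0 T) :=
    (M - N).continuous.comp_continuousOn h.continuousOn
  have hsub : ∀ t ∈ Set.Icc 0 T, Set.uIcc 0 t ⊆ Set.uIcc 0 T := fun t ht => by
    rw [Set.uIcc_of_le ht.1, Set.uIcc_of_le hT]; exact Set.Icc_subset_Icc_right ht.2
  refine ⟨h₁.continuousOn.sub h.continuousOn, ContinuousOn.intervalIntegrable
    (by rwa [Set.uIcc_of_le hT]), fun t ht => ?_, fun t ht => ?_⟩
  · have i1 : IntervalIntegrable y₁ volume 0 t := ContinuousOn.intervalIntegrable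
      ((h₁.continuousOn_velocity hT).mono (by rw [← Set.uIcc_of_le hT]; exact hsub t ht))
    have i2 : IntervalIntegrable y volume 0 t := ContinuousOn.intervalIntegrable
      ((h.continuousOn_velocity hT).mono (by rw [← Set.uIcc_of_le hT]; exact hsub t ht))
    rw [intervalIntegral.integral_sub i1 i2, h₁.position t ht, h.position t ht]
    abel
  · have i1 := (h₁.intervalIntegrable_acceleration hT).mono_set (hsub t ht)
    have i2 := (h.intervalIntegrable_acceleration hT).mono_set (hsub t ht)
    have e : ∀ s, (M - N) (x s) - N (x₁ s - x s)
        = (F s - N (x₁ s)) - (F s - M (x s)) := fun s => by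
      simp only [sub_apply, map_sub]; abel
    simp only [e]
    rw [intervalIntegral.integral_sub i1 i2]
    rw [h₁.velocity t ht, h.velocity t ht]
    abel

end IsModeSolution

end ModeEquation

/-! ### Characters of the torus and Parseval's identity on the cell -/

open ComplexConjugate Real

/-- The character `x ↦ exp(i k · x)`. -/
def character (k : Fin 2 → ℤ) (x : Plane) : ℂ :=
  Complex.exp (Complex.I * ((∑ j, (k j : ℝ) * x j : ℝ) : ℂ))

theorem character_add (k : Fin 2 → ℤ) (x y : Plane) :
    character k (x + y) = character k x * character k y := by
  rw [character, character, character, ← Complex.exp_add, ← mul_add, ← Complex.ofReal_add,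
    ← Finset.sum_add_distrib]
  simp only [PiLp.add_apply, mul_add]

@[simp] theorem norm_character (k : Fin 2 → ℤ) (x : Plane) : ‖character k x‖ = 1 := by
  rw [character, mul_comm, Complex.norm_exp_ofReal_mul_I]

theorem character_neg_left (k : Fin 2 → ℤ) (x : Plane) :
    character (-k) x = conj (character k x) := by
  rw [character, character, ← Complex.exp_conj, map_mul, Complex.conj_I, Complex.conj_ofReal]
  congr 1
  simp only [Pi.neg_apply, Int.cast_neg, neg_mul, Finset.sum_neg_distrib, Complex.ofReal_neg,
    mul_neg]

@[simp] theorem character_zero_left (x : Plane) : character 0 x = 1 := by simp [character]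

theorem character_add_left (k l : Fin 2 → ℤ) (x : Plane) :
    character (k + l) x = character k x * character l x := by
  rw [character, character, character, ← Complex.exp_add, ← mul_add, ← Complex.ofReal_add,
    ← Finset.sum_add_distrib]
  simp only [Pi.add_apply, Int.cast_add, add_mul]

theorem contDiff_character (k : Fin 2 → ℤ) : ContDiff ℝ ∞ (character k) := by
  have h : ContDiff ℝ ∞ fun x : Plane => ((∑ j, (k j : ℝ) * x j : ℝ) : ℂ) :=
    Complex.ofRealCLM.contDiff.comp (by fun_prop : ContDiff ℝ ∞ fun x : Plane => ∑ j, (k j : ℝ) * x j)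
  exact Complex.contDiff_exp.comp (contDiff_const.mul h)

@[fun_prop] theorem continuous_character (k : Fin 2 → ℤ) : Continuous (character k) :=
  (contDiff_character k).continuous

theorem isPeriodic_character (k : Fin 2 → ℤ) : IsPeriodic (character k) := by
  intro x i
  rw [character_add]
  have : character k (EuclideanSpace.single i (2 * π)) = 1 := by
    rw [character, Complex.exp_eq_one_iff]
    refine ⟨k i, ?_⟩
    simp [PiLp.single_apply]
    ring
  rw [this, mul_one]

theorem cell_eq_preimage : cell = (WithLp.ofLp : Plane → Fin 2 → ℝ) ⁻¹'
    Set.univ.pi fun _ => Set.Ioo (-π) π := by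
  ext x; simp [cell]

theorem volume_cell : volume cell = ENNReal.ofReal (2 * π) ^ 2 := by
  rw [cell_eq_preimage, (PiLp.volume_preserving_ofLp (Fin 2)).measure_preimage
    (MeasurableSet.univ_pi fun _ => measurableSet_Ioo).nullMeasurableSet, volume_pi_pi]
  simp [sq, two_mul]

instance isFiniteMeasure_cell : IsFiniteMeasure (volume.restrict cell) :=
  ⟨by rw [Measure.restrict_apply_univ, volume_cell]; finiteness⟩

/-- The probability measure on the circle that Mathlib's Fourier series on tori refer to. -/
local instance measureSpaceCircle : MeasureSpace UnitAddCircle := ⟨AddCircle.haarAddCircle⟩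

local instance isProbabilityMeasureCircle : IsProbabilityMeasure (volume : Measure UnitAddCircle) :=
  inferInstanceAs (IsProbabilityMeasure AddCircle.haarAddCircle)

/-- The fundamental domain `(-π, π]` of the circle `ℝ / ℤ`, as a section of `x ↦ x / (2π)`. -/
def circleSection (τ : UnitAddCircle) : ℝ := 2 * π * (AddCircle.equivIoc 1 (-(1 / 2)) τ : ℝ)

theorem measurePreserving_circleSection :
    MeasurePreserving circleSection volume
      ((ENNReal.ofReal (2 * π))⁻¹ • volume.restrict (Set.Ioo (-π) π)) := by
  have h1 : MeasurePreserving (fun τ : UnitAddCircle => (AddCircle.equivIoc 1 (-(1 / 2)) τ : ℝ))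
      volume (volume.restrict (Set.Ioc (-(1 / 2)) (-(1 / 2) + 1))) := by
    have := (measurePreserving_subtype_coe (μa := (volume : Measure ℝ))
      (measurableSet_Ioc (a := -(1 / 2 : ℝ)) (b := -(1 / 2) + 1))).comp
      (AddCircle.measurePreserving_equivIoc 1 (a := -(1 / 2)))
    convert! this using 1
    change AddCircle.haarAddCircle = _
    rw [AddCircle.volume_eq_smul_haarAddCircle]
    simp
  have h2 : MeasurePreserving (fun x : ℝ => 2 * π * x)
      (volume.restrict (Set.Ioc (-(1 / 2)) (-(1 / 2) + 1)))
      ((ENNReal.ofReal (2 * π))⁻¹ • volume.restrict (Set.Ioc (-π) π)) := by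
    have h3 : MeasurePreserving (fun x : ℝ => 2 * π * x) volume
        ((ENNReal.ofReal (2 * π))⁻¹ • volume) := by
      refine ⟨by fun_prop, ?_⟩
      rw [Real.map_volume_mul_left (by positivity), abs_of_pos (by positivity),
        ENNReal.ofReal_inv_of_pos (by positivity)]
    have := h3.restrict_preimage (measurableSet_Ioc (a := -π) (b := π))
    rw [Measure.restrict_smul] at this
    convert! this using 2
    ext x
    have := Real.pi_pos
    simp only [Set.mem_Ioc, Set.mem_preimage]
    constructor <;> rintro ⟨h, h'⟩ <;> constructor <;> nlinarith
  have h4 := h2.comp h1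
  rw [← Measure.restrict_congr_set (Ioo_ae_eq_Ioc)] at h4
  exact h4

/-- The fundamental domain `(-π, π]²` of the torus, as a section of `x ↦ x / (2π)`. -/
def torusSection (τ : UnitAddTorus (Fin 2)) : Plane := WithLp.toLp 2 fun i => circleSection (τ i)

theorem measurePreserving_torusSection :
    MeasurePreserving torusSection volume
      ((ENNReal.ofReal (2 * π) ^ 2)⁻¹ • volume.restrict cell) := by
  have : IsFiniteMeasure
      ((ENNReal.ofReal (2 * π))⁻¹ • (volume : Measure ℝ).restrict (Set.Ioo (-π) π)) := by
    refine Measure.smul_finite _ ?_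
    rw [ENNReal.inv_ne_top]
    have := Real.pi_pos
    positivity
  have h1 := measurePreserving_pi (fun _ : Fin 2 => (volume : Measure UnitAddCircle))
    (fun _ => (ENNReal.ofReal (2 * π))⁻¹ • volume.restrict (Set.Ioo (-π) π))
    (fun _ => measurePreserving_circleSection)
  have h2 : Measure.pi (fun _ : Fin 2 =>
      (ENNReal.ofReal (2 * π))⁻¹ • (volume : Measure ℝ).restrict (Set.Ioo (-π) π))
      = (ENNReal.ofReal (2 * π) ^ 2)⁻¹ • (volume : Measure (Fin 2 → ℝ)).restrict
        (Set.univ.pi fun _ => Set.Ioo (-π) π) := by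
    apply Measure.pi_eq
    intro s hs
    rw [volume_pi, Measure.restrict_pi_pi, Measure.smul_apply, Measure.pi_pi]
    simp only [Fin.prod_univ_two, Measure.smul_apply, smul_eq_mul]
    rw [ENNReal.inv_pow]
    ring
  rw [h2] at h1
  have h3 := ((PiLp.volume_preserving_ofLp (Fin 2)).restrict_preimage
    (MeasurableSet.univ_pi fun _ : Fin 2 => measurableSet_Ioo (a := -π) (b := π)))
  rw [← cell_eq_preimage] at h3
  have h4 : MeasurePreserving (MeasurableEquiv.toLp 2 (Fin 2 → ℝ))
      ((volume : Measure (Fin 2 → ℝ)).restrict (Set.univ.pi fun _ => Set.Ioo (-π) π))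
      (volume.restrict cell) :=
    MeasurePreserving.symm (MeasurableEquiv.toLp 2 (Fin 2 → ℝ)).symm h3
  have h5 := (h4.smul_measure (ENNReal.ofReal (2 * π) ^ 2)⁻¹).comp h1
  exact h5

theorem mFourier_eq_character_torusSection (k : Fin 2 → ℤ) (τ : UnitAddTorus (Fin 2)) :
    UnitAddTorus.mFourier k τ = character k (torusSection τ) := by
  have hτ : ∀ i, τ i = ((AddCircle.equivIoc 1 (-(1 / 2)) (τ i) : ℝ) : UnitAddCircle) := fun i =>
    ((AddCircle.equivIoc (1 : ℝ) (-(1 / 2))).symm_apply_apply (τ i)).symm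
  simp only [UnitAddTorus.mFourier, ContinuousMap.coe_mk]
  rw [character, Complex.ofReal_sum, Finset.mul_sum, Complex.exp_sum]
  refine Finset.prod_congr rfl fun i _ => ?_
  conv_lhs => rw [hτ i]
  rw [fourier_coe_apply]
  congr 1
  simp only [torusSection, circleSection]
  push_cast
  ring

theorem integral_comp_torusSection {E : Type*} [NormedAddCommGroup E] [NormedSpace ℝ E]
    {f : Plane → E} (hf : AEStronglyMeasurable f (volume.restrict cell)) :
    ∫ τ, f (torusSection τ) = ((2 * π) ^ 2)⁻¹ • ∫ x in cell, f x := by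
  have hm := measurePreserving_torusSection
  rw [← integral_map hm.measurable.aemeasurable
    (by rw [hm.map_eq]; exact hf.smul_measure _), hm.map_eq, integral_smul_measure]
  congr 1
  rw [ENNReal.toReal_inv, ENNReal.toReal_pow, ENNReal.toReal_ofReal (by positivity)]

theorem integral_character (k : Fin 2 → ℤ) :
    ∫ x in cell, character k x = if k = 0 then ((2 * π) ^ 2 : ℂ) else 0 := by
  have h := integral_comp_torusSection (f := character k)
    (continuous_character k).aestronglyMeasurable
  simp only [← mFourier_eq_character_torusSection] at h
  have h2 := orthonormal_iff_ite.1 (UnitAddTorus.orthonormal_mFourier (d := Fin 2)) 0 k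
  simp only [ContinuousMap.inner_toLp, UnitAddTorus.mFourier_zero] at h2
  simp only [ContinuousMap.one_apply, map_one, mul_one] at h2
  rw [h] at h2
  have hpi : ((2 * π : ℝ) : ℂ) ^ 2 ≠ 0 := by
    have := Real.pi_pos.ne'
    norm_cast
    positivity
  have h3 : ∫ x in cell, character k x
      = (((2 * π) ^ 2 : ℝ) : ℂ) * (((2 * π) ^ 2)⁻¹ : ℝ) • ∫ x in cell, character k x := by
    rw [Complex.real_smul, ← mul_assoc]
    push_cast at hpi ⊢
    rw [mul_inv_cancel₀ hpi, one_mul]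
  rw [h3, h2]
  simp [eq_comm]

/-- Fourier coefficients, normalized so that the transform is an isometry of `L²(Ω)` onto `ℓ²`. -/
def cellCoeff (f : Plane → ℂ) (k : Fin 2 → ℤ) : ℂ :=
  (2 * π : ℂ)⁻¹ * ∫ x in cell, conj (character k x) * f x

theorem hasSum_sq_norm_cellCoeff {f : Plane → ℂ} (hf : MemLp f 2 (volume.restrict cell)) :
    HasSum (fun k => ‖cellCoeff f k‖ ^ 2) (∫ x in cell, ‖f x‖ ^ 2) := by
  have hm := measurePreserving_torusSection
  have hF : MemLp (fun τ => f (torusSection τ)) 2 (volume : Measure (UnitAddTorus (Fin 2))) := by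
    refine MemLp.comp_measurePreserving (ν := (ENNReal.ofReal (2 * π) ^ 2)⁻¹ • volume.restrict cell)
      ?_ hm
    refine hf.smul_measure ?_
    rw [ENNReal.inv_ne_top]
    have := Real.pi_pos
    positivity
  have h := UnitAddTorus.hasSum_sq_mFourierCoeff (hF.toLp _)
  have hc : ∀ k, UnitAddTorus.mFourierCoeff (hF.toLp _) k = (2 * π : ℂ)⁻¹ * cellCoeff f k := by
    intro k
    have e1 : UnitAddTorus.mFourierCoeff (hF.toLp _) k
        = ∫ τ, conj (character k (torusSection τ)) * f (torusSection τ) := by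
      refine integral_congr_ae ?_
      filter_upwards [MemLp.coeFn_toLp hF] with τ hτ
      rw [hτ, UnitAddTorus.mFourier_neg, mFourier_eq_character_torusSection, smul_eq_mul]
    rw [e1, integral_comp_torusSection (f := fun x => conj (character k x) * f x)
      ((by fun_prop : Continuous fun x => conj (character k x)).aestronglyMeasurable.mul hf.1),
      cellCoeff, Complex.real_smul]
    push_cast
    ring
  have hs : ∫ τ, ‖(hF.toLp _) τ‖ ^ 2 = ((2 * π) ^ 2)⁻¹ * ∫ x in cell, ‖f x‖ ^ 2 := by
    rw [← smul_eq_mul, ← integral_comp_torusSection (f := fun x => ‖f x‖ ^ 2) (hf.1.norm.pow 2)]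
    refine integral_congr_ae ?_
    filter_upwards [MemLp.coeFn_toLp hF] with τ hτ
    rw [hτ]
  rw [hs] at h
  have h' := h.mul_left ((2 * π) ^ 2)
  have hpi : (2 * π) ^ 2 ≠ 0 := by positivity
  rw [← mul_assoc, mul_inv_cancel₀ hpi, one_mul] at h'
  refine h'.congr_fun fun k => ?_
  rw [hc, norm_mul, mul_pow, norm_inv]
  have : ‖(2 * π : ℂ)‖ = 2 * π := by
    rw [norm_mul, Complex.norm_real, Complex.norm_ofNat, Real.norm_of_nonneg Real.pi_pos.le]
  rw [this]
  field_simp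

/-! ### Fourier coefficients of square-integrable vector fields -/

theorem cellCoeff_congr {f g : Plane → ℂ} (h : f =ᵐ[volume.restrict cell] g) (k : Fin 2 → ℤ) :
    cellCoeff f k = cellCoeff g k := by
  unfold cellCoeff
  congr 1
  refine integral_congr_ae ?_
  filter_upwards [h] with x hx
  rw [hx]

theorem integrable_conj_character_mul {f : Plane → ℂ} (hf : MemLp f 2 (volume.restrict cell))
    (k : Fin 2 → ℤ) :
    Integrable (fun x => conj (character k x) * f x) (volume.restrict cell) := by
  refine (hf.integrable one_le_two).bdd_mul (c := 1)
    (by fun_prop : Continuous fun x => conj (character k x)).aestronglyMeasurable ?_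
  exact ae_of_all _ fun x => by simp

theorem integrable_character_mul {f : Plane → ℂ} (hf : MemLp f 2 (volume.restrict cell))
    (k : Fin 2 → ℤ) :
    Integrable (fun x => character k x * f x) (volume.restrict cell) := by
  refine (hf.integrable one_le_two).bdd_mul (c := 1)
    (continuous_character k).aestronglyMeasurable ?_
  exact ae_of_all _ fun x => by simp

theorem cellCoeff_add {f g : Plane → ℂ} (hf : MemLp f 2 (volume.restrict cell))
    (hg : MemLp g 2 (volume.restrict cell)) (k : Fin 2 → ℤ) :
    cellCoeff (fun x => f x + g x) k = cellCoeff f k + cellCoeff g k := by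
  simp only [cellCoeff, mul_add]
  rw [integral_add (integrable_conj_character_mul hf k) (integrable_conj_character_mul hg k),
    mul_add]


theorem cellCoeff_const_mul (c : ℂ) (f : Plane → ℂ) (k : Fin 2 → ℤ) :
    cellCoeff (fun x => c * f x) k = c * cellCoeff f k := by
  simp only [cellCoeff, mul_left_comm _ c]
  rw [integral_const_mul, mul_left_comm]

theorem cellCoeff_ofReal_neg (f : Plane → ℝ) (k : Fin 2 → ℤ) :
    cellCoeff (fun x => (f x : ℂ)) (-k) = conj (cellCoeff (fun x => (f x : ℂ)) k) := by
  simp only [cellCoeff, map_mul, ← integral_conj, character_neg_left, Complex.conj_conj,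
    Complex.conj_ofReal, map_inv₀, map_ofNat]

/-- The space `ℂ²` of the Fourier coefficients of a vector field, as a real Hilbert space. -/
abbrev ModeSpace : Type := EuclideanSpace ℂ (Fin 2)

theorem inner_modeSpace (a b : ModeSpace) : inner ℝ a b = (∑ j, conj (a j) * b j).re := by
  simp only [PiLp.inner_apply, Complex.inner, Complex.re_sum]
  exact Finset.sum_congr rfl fun j _ => by rw [mul_comm]

theorem memLp_coord (u : L2) (j : Fin 2) :
    MemLp (fun x => ((u x j : ℝ) : ℂ)) 2 (volume.restrict cell) := by
  have h : MemLp (fun x => u x j) 2 (volume.restrict cell) :=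
    (EuclideanSpace.proj (𝕜 := ℝ) j : Plane →L[ℝ] ℝ).comp_memLp' (Lp.memLp u)
  exact h.ofReal

theorem norm_sq_eq_sum_integral (u : L2) :
    ‖u‖ ^ 2 = ∑ j, ∫ x in cell, ‖((u x j : ℝ) : ℂ)‖ ^ 2 := by
  rw [← real_inner_self_eq_norm_sq, L2.inner_def, ← integral_finsetSum]
  · refine integral_congr_ae (ae_of_all _ fun x => ?_)
    simp only [real_inner_self_eq_norm_sq, EuclideanSpace.norm_sq_eq, Complex.norm_real]
  · intro j _
    exact (memLp_two_iff_integrable_sq_norm (memLp_coord u j).1).1 (memLp_coord u j)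

theorem hasSum_sq_norm_coord (u : L2) :
    HasSum (fun k => ‖(WithLp.toLp 2 fun j => cellCoeff (fun x => ((u x j : ℝ) : ℂ)) k : ModeSpace)‖ ^ 2)
      (‖u‖ ^ 2) := by
  simp only [EuclideanSpace.norm_sq_eq]
  rw [norm_sq_eq_sum_integral]
  exact hasSum_sum fun j _ => hasSum_sq_norm_cellCoeff (memLp_coord u j)

/-- The Fourier coefficient `(2π)⁻¹ ∫_Ω u(x) exp(-i k · x) dx` of a vector field. -/
def modeCoeff (k : Fin 2 → ℤ) : L2 →L[ℝ] ModeSpace :=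
  LinearMap.mkContinuous
    { toFun := fun u => WithLp.toLp 2 fun j => cellCoeff (fun x => ((u x j : ℝ) : ℂ)) k
      map_add' := fun u v => by
        ext j
        simp only [PiLp.add_apply]
        rw [← cellCoeff_add (memLp_coord u j) (memLp_coord v j)]
        refine cellCoeff_congr ?_ k
        filter_upwards [Lp.coeFn_add u v] with x hx
        rw [hx, Pi.add_apply, PiLp.add_apply, Complex.ofReal_add]
      map_smul' := fun r u => by
        ext j
        simp only [PiLp.smul_apply, RingHom.id_apply, Complex.real_smul]
        rw [← cellCoeff_const_mul]
        refine cellCoeff_congr ?_ k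
        filter_upwards [Lp.coeFn_smul r u] with x hx
        rw [hx, Pi.smul_apply, PiLp.smul_apply, smul_eq_mul, Complex.ofReal_mul] } 1
    fun u => by
      rw [one_mul]
      refine le_of_sq_le_sq ?_ (norm_nonneg u)
      exact le_hasSum (hasSum_sq_norm_coord u) k fun _ _ => by positivity

theorem modeCoeff_apply (k : Fin 2 → ℤ) (u : L2) (j : Fin 2) :
    modeCoeff k u j = cellCoeff (fun x => ((u x j : ℝ) : ℂ)) k := rfl

theorem hasSum_sq_norm_modeCoeff (u : L2) : HasSum (fun k => ‖modeCoeff k u‖ ^ 2) (‖u‖ ^ 2) :=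
  hasSum_sq_norm_coord u

theorem modeCoeff_neg (k : Fin 2 → ℤ) (u : L2) (j : Fin 2) :
    modeCoeff (-k) u j = conj (modeCoeff k u j) := by
  simp only [modeCoeff_apply, cellCoeff_ofReal_neg]

theorem modeCoeff_zero_eq_zero {u : L2} (hu : ∫ x in cell, u x = 0) : modeCoeff 0 u = 0 := by
  ext j
  have h := (EuclideanSpace.proj (𝕜 := ℝ) j : Plane →L[ℝ] ℝ).integral_comp_comm
    ((Lp.memLp u).integrable one_le_two)
  rw [hu, map_zero] at h
  simp only [PiLp.proj_apply] at h
  simp only [modeCoeff_apply, cellCoeff, character_zero_left, map_one, one_mul]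
  rw [integral_complex_ofReal, h]
  simp

/-! ### Real trigonometric polynomials -/

/-- The real part of `∑ k ∈ S, c k exp(i k · x)`. -/
def trigPoly (S : Finset (Fin 2 → ℤ)) (c : (Fin 2 → ℤ) → ℂ) (x : Plane) : ℝ :=
  (∑ k ∈ S, c k * character k x).re

/-- The vector field with components the trigonometric polynomials with coefficients `a k`. -/
def trigField (S : Finset (Fin 2 → ℤ)) (a : (Fin 2 → ℤ) → ModeSpace) (x : Plane) : Plane :=
  WithLp.toLp 2 fun j => trigPoly S (fun k => a k j) x

theorem contDiff_trigPoly (S : Finset (Fin 2 → ℤ)) (c : (Fin 2 → ℤ) → ℂ) :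
    ContDiff ℝ ∞ (trigPoly S c) :=
  Complex.reCLM.contDiff.comp
    (ContDiff.sum fun k _ => contDiff_const.mul (contDiff_character k))

@[fun_prop] theorem continuous_trigPoly (S : Finset (Fin 2 → ℤ)) (c : (Fin 2 → ℤ) → ℂ) :
    Continuous (trigPoly S c) := (contDiff_trigPoly S c).continuous

theorem contDiff_trigField (S : Finset (Fin 2 → ℤ)) (a : (Fin 2 → ℤ) → ModeSpace) :
    ContDiff ℝ ∞ (trigField S a) :=
  contDiff_euclidean.2 fun j => contDiff_trigPoly S fun k => a k j

theorem isPeriodic_trigPoly (S : Finset (Fin 2 → ℤ)) (c : (Fin 2 → ℤ) → ℂ) :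
    IsPeriodic (trigPoly S c) := fun x i => by
  simp only [trigPoly, isPeriodic_character _ x i]

theorem norm_trigPoly_le (S : Finset (Fin 2 → ℤ)) (c : (Fin 2 → ℤ) → ℂ) (x : Plane) :
    ‖trigPoly S c x‖ ≤ ∑ k ∈ S, ‖c k‖ := by
  refine (Complex.abs_re_le_norm _).trans ((norm_sum_le _ _).trans (le_of_eq ?_))
  simp

theorem memLp_trigPoly (S : Finset (Fin 2 → ℤ)) (c : (Fin 2 → ℤ) → ℂ) (p : ℝ≥0∞) :
    MemLp (trigPoly S c) p (volume.restrict cell) :=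
  MemLp.of_bound (continuous_trigPoly S c).aestronglyMeasurable _ (ae_of_all _ (norm_trigPoly_le S c))

theorem norm_le_sum_norm_coord (v : Plane) : ‖v‖ ≤ ∑ j, ‖v j‖ := by
  refine le_of_sq_le_sq ?_ (by positivity)
  rw [EuclideanSpace.norm_sq_eq, Fin.sum_univ_two, Fin.sum_univ_two]
  nlinarith [norm_nonneg (v 0), norm_nonneg (v 1)]

theorem memLp_trigField (S : Finset (Fin 2 → ℤ)) (a : (Fin 2 → ℤ) → ModeSpace) (p : ℝ≥0∞) :
    MemLp (trigField S a) p (volume.restrict cell) := by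
  refine MemLp.of_bound (contDiff_trigField S a).continuous.aestronglyMeasurable
    (∑ j : Fin 2, ∑ k ∈ S, ‖a k j‖) (ae_of_all _ fun x => ?_)
  refine (norm_le_sum_norm_coord _).trans ?_
  exact Finset.sum_le_sum fun j _ => norm_trigPoly_le S _ x

theorem integral_trigPoly {S : Finset (Fin 2 → ℤ)} {c : (Fin 2 → ℤ) → ℂ} (h0 : c 0 = 0) :
    ∫ x in cell, trigPoly S c x = 0 := by
  have hi : ∀ k, Integrable (fun x => c k * character k x) (volume.restrict cell) := fun k =>
    (MemLp.of_bound (p := 1) (by fun_prop : Continuous fun x => c k * character k x).aestronglyMeasurable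
      ‖c k‖ (ae_of_all _ fun x => by simp)).integrable le_rfl
  have h := Complex.reCLM.integral_comp_comm (integrable_finsetSum S fun k _ => hi k)
  simp only [Complex.reCLM_apply] at h
  unfold trigPoly
  rw [h, integral_finsetSum _ fun k _ => hi k, Finset.sum_eq_zero, Complex.zero_re]
  intro k _
  rw [integral_const_mul, integral_character]
  by_cases hk : k = 0
  · simp [hk, h0]
  · simp [hk]

theorem isTestField_trigField {S : Finset (Fin 2 → ℤ)} {a : (Fin 2 → ℤ) → ModeSpace}
    (h0 : a 0 = 0) : IsTestField (trigField S a) where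
  smooth := contDiff_trigField S a
  periodic := fun x i => by simp only [trigField, isPeriodic_trigPoly _ _ x i]
  mean_zero := by
    ext j
    have h := (EuclideanSpace.proj (𝕜 := ℝ) j : Plane →L[ℝ] ℝ).integral_comp_comm
      ((memLp_trigField S a 1).integrable le_rfl)
    simp only [PiLp.proj_apply] at h
    rw [← h]
    exact integral_trigPoly (by simp [h0])

theorem integral_trigPoly_mul {f : Plane → ℝ}
    (hf : MemLp (fun x => (f x : ℂ)) 2 (volume.restrict cell)) (k : Fin 2 → ℤ)
    (c : (Fin 2 → ℤ) → ℂ) :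
    ∫ x in cell, trigPoly {k} c x * f x
      = 2 * π * (conj (cellCoeff (fun x => (f x : ℂ)) k) * c k).re := by
  have hi : Integrable (fun x => c k * (character k x * (f x : ℂ))) (volume.restrict cell) :=
    (integrable_character_mul hf k).const_mul _
  have h1 : conj (cellCoeff (fun x => (f x : ℂ)) k) * c k
      = ((2 * π)⁻¹ : ℝ) * ∫ x in cell, c k * (character k x * (f x : ℂ)) := by
    rw [cellCoeff, map_mul, ← integral_conj, integral_const_mul]
    simp only [map_mul, Complex.conj_conj, Complex.conj_ofReal, map_inv₀, map_ofNat]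
    push_cast
    ring
  have h3 := Complex.reCLM.integral_comp_comm hi
  simp only [Complex.reCLM_apply] at h3
  rw [h1, Complex.re_ofReal_mul, ← h3, ← mul_assoc, mul_inv_cancel₀ (by positivity), one_mul]
  refine integral_congr_ae (ae_of_all _ fun x => ?_)
  simp only [trigPoly, Finset.sum_singleton]
  rw [← mul_assoc, Complex.re_mul_ofReal]

theorem integrable_trigPoly_mul {f : Plane → ℝ}
    (hf : MemLp (fun x => (f x : ℂ)) 2 (volume.restrict cell)) (S : Finset (Fin 2 → ℤ))
    (c : (Fin 2 → ℤ) → ℂ) :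
    Integrable (fun x => trigPoly S c x * f x) (volume.restrict cell) := by
  have h : Integrable f (volume.restrict cell) := by
    simpa using (hf.integrable one_le_two).re
  exact h.bdd_mul (continuous_trigPoly S c).aestronglyMeasurable
    (ae_of_all _ (norm_trigPoly_le S c))

theorem pairing_trigField (u : L2) (k : Fin 2 → ℤ) (a : (Fin 2 → ℤ) → ModeSpace) :
    pairing u (trigField {k} a) = 2 * π * inner ℝ (modeCoeff k u) (a k) := by
  rw [inner_modeSpace, pairing, Complex.re_sum, Finset.mul_sum]
  have e : ∀ x, inner ℝ (u x) (trigField {k} a x)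
      = ∑ j, trigPoly {k} (fun k => a k j) x * u x j := fun x => by
    simp only [PiLp.inner_apply, trigField, RCLike.inner_apply, conj_trivial]
  simp only [e]
  rw [integral_finsetSum _ fun j _ => integrable_trigPoly_mul (memLp_coord u j) _ _]
  exact Finset.sum_congr rfl fun j _ => integral_trigPoly_mul (memLp_coord u j) k _

/-- With symmetric frequencies and Hermitian coefficients, the trigonometric sum is already real. -/
theorem ofReal_trigPoly {S : Finset (Fin 2 → ℤ)} {c : (Fin 2 → ℤ) → ℂ}
    (hS : ∀ k ∈ S, -k ∈ S) (hc : ∀ k, c (-k) = conj (c k)) (x : Plane) :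
    (trigPoly S c x : ℂ) = ∑ k ∈ S, c k * character k x := by
  rw [trigPoly]
  apply Complex.conj_eq_iff_re.1
  rw [map_sum]
  refine Finset.sum_nbij' (fun k => -k) (fun k => -k) hS hS (fun k _ => neg_neg k)
    (fun k _ => neg_neg k) fun k _ => ?_
  rw [map_mul, hc, character_neg_left]

theorem cellCoeff_trigPoly {S : Finset (Fin 2 → ℤ)} {c : (Fin 2 → ℤ) → ℂ}
    (hS : ∀ k ∈ S, -k ∈ S) (hc : ∀ k, c (-k) = conj (c k)) (k : Fin 2 → ℤ) :
    cellCoeff (fun x => (trigPoly S c x : ℂ)) k = if k ∈ S then 2 * π * c k else 0 := by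
  simp only [ofReal_trigPoly hS hc, cellCoeff, Finset.mul_sum]
  have he : ∀ l x, conj (character k x) * (c l * character l x) = c l * character (-k + l) x :=
    fun l x => by rw [character_add_left, character_neg_left]; ring
  simp only [he]
  have hi : ∀ l, Integrable (fun x => c l * character (-k + l) x) (volume.restrict cell) := fun l =>
    (MemLp.of_bound (p := 1)
      (by fun_prop : Continuous fun x => c l * character (-k + l) x).aestronglyMeasurable
      ‖c l‖ (ae_of_all _ fun x => by simp)).integrable le_rfl
  rw [integral_finsetSum _ fun l _ => hi l]
  have hz : ∀ l, -k + l = 0 ↔ k = l := fun l => by rw [neg_add_eq_zero]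
  simp only [integral_const_mul, integral_character, hz, mul_ite, mul_zero, Finset.sum_ite_eq]
  split_ifs
  · have : (2 * π : ℂ) ≠ 0 := by
      have := Real.pi_pos.ne'
      simp [this]
    field_simp
  · rfl

theorem integral_sq_trigPoly {S : Finset (Fin 2 → ℤ)} {c : (Fin 2 → ℤ) → ℂ}
    (hS : ∀ k ∈ S, -k ∈ S) (hc : ∀ k, c (-k) = conj (c k)) :
    ∫ x in cell, trigPoly S c x ^ 2 = (2 * π) ^ 2 * ∑ k ∈ S, ‖c k‖ ^ 2 := by
  have h := hasSum_sq_norm_cellCoeff (f := fun x => (trigPoly S c x : ℂ)) (memLp_trigPoly S c 2).ofReal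
  have h' := hasSum_sum_of_ne_finset_zero (L := .unconditional _) (f := fun k =>
    ‖cellCoeff (fun x => (trigPoly S c x : ℂ)) k‖ ^ 2) (s := S) (fun k hk => by
      rw [cellCoeff_trigPoly hS hc, if_neg hk]; simp)
  have e := h.unique h'
  simp only [Complex.norm_real, Real.norm_eq_abs, sq_abs] at e
  rw [e, Finset.mul_sum]
  refine Finset.sum_congr rfl fun k hk => ?_
  rw [cellCoeff_trigPoly hS hc, if_pos hk, norm_mul, mul_pow, norm_mul, Complex.norm_real,
    Complex.norm_ofNat, Real.norm_of_nonneg Real.pi_pos.le]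

/-! ### Fourier truncations -/

/-- The frequencies with entries between `-N` and `N`. -/
def freqBox (N : ℕ) : Finset (Fin 2 → ℤ) := Fintype.piFinset fun _ => Finset.Icc (-(N : ℤ)) N

theorem mem_freqBox {N : ℕ} {k : Fin 2 → ℤ} : k ∈ freqBox N ↔ ∀ i, -(N : ℤ) ≤ k i ∧ k i ≤ N := by
  simp [freqBox]

theorem neg_mem_freqBox {N : ℕ} (k : Fin 2 → ℤ) (hk : k ∈ freqBox N) : -k ∈ freqBox N := by
  rw [mem_freqBox] at hk ⊢
  intro i
  have := hk i
  simp only [Pi.neg_apply]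
  constructor <;> linarith

theorem tendsto_freqBox : Tendsto freqBox atTop atTop := by
  refine tendsto_atTop_finset_of_monotone (fun M N h k hk => ?_) fun k => ?_
  · rw [mem_freqBox] at hk ⊢
    intro i
    have := hk i
    have : (M : ℤ) ≤ N := by exact_mod_cast h
    constructor <;> linarith
  · refine ⟨∑ i, (k i).natAbs, mem_freqBox.2 fun i => ?_⟩
    have h1 : (k i).natAbs ≤ ∑ i, (k i).natAbs :=
      Finset.single_le_sum (f := fun i => (k i).natAbs) (fun _ _ => Nat.zero_le _) (Finset.mem_univ i)
    omega

/-- The truncated Fourier series of `u`. -/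
def fourierTruncation (u : L2) (N : ℕ) : Plane → Plane :=
  trigField (freqBox N) fun k => (2 * π)⁻¹ • modeCoeff k u

theorem isTestField_fourierTruncation {u : L2} (hu : modeCoeff 0 u = 0) (N : ℕ) :
    IsTestField (fourierTruncation u N) :=
  isTestField_trigField (by rw [hu, smul_zero])

theorem tendsto_eLpNorm_fourierTruncation_sub (u : L2) :
    Tendsto (fun N => eLpNorm (fun x => fourierTruncation u N x - u x) 2 (volume.restrict cell))
      atTop (𝓝 0) := by
  have hm : ∀ N, MemLp (fourierTruncation u N) 2 (volume.restrict cell) := fun N =>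
    memLp_trigField _ _ _
  have hcoef : ∀ N k, modeCoeff k (((hm N).toLp _) - u)
      = if k ∈ freqBox N then 0 else -modeCoeff k u := by
    intro N k
    rw [map_sub]
    have : modeCoeff k ((hm N).toLp _) = if k ∈ freqBox N then modeCoeff k u else 0 := by
      ext j
      rw [modeCoeff_apply]
      have e : cellCoeff (fun x => (((hm N).toLp _ : L2) x j : ℂ)) k
          = cellCoeff (fun x => (trigPoly (freqBox N)
              (fun k => ((2 * π)⁻¹ • modeCoeff k u) j) x : ℂ)) k := by
        refine cellCoeff_congr ?_ k
        filter_upwards [(hm N).coeFn_toLp] with x hx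
        rw [hx]
        rfl
      rw [e, cellCoeff_trigPoly neg_mem_freqBox]
      · split_ifs
        · have : (2 * π : ℂ) ≠ 0 := by
            have := Real.pi_pos.ne'
            simp [this]
          simp only [PiLp.smul_apply, Complex.real_smul]
          push_cast
          rw [← mul_assoc, mul_inv_cancel₀ this, one_mul]
        · rfl
      · intro k
        simp only [PiLp.smul_apply, modeCoeff_neg, Complex.real_smul, map_mul, Complex.conj_ofReal]
    rw [this]
    split_ifs <;> simp
  have hnorm : ∀ N, ‖((hm N).toLp _) - u‖ ^ 2
      = ‖u‖ ^ 2 - ∑ k ∈ freqBox N, ‖modeCoeff k u‖ ^ 2 := by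
    intro N
    have h1 := hasSum_sq_norm_modeCoeff (((hm N).toLp _) - u)
    have h2 := (hasSum_sq_norm_modeCoeff u).sub (hasSum_sum_of_ne_finset_zero
      (f := fun k => if k ∈ freqBox N then ‖modeCoeff k u‖ ^ 2 else 0) (s := freqBox N)
      fun k hk => if_neg hk)
    rw [Finset.sum_congr rfl fun k hk => if_pos hk] at h2
    refine h1.unique (h2.congr_fun fun k => ?_)
    rw [hcoef]
    split_ifs <;> simp
  have hlim : Tendsto (fun N => ‖((hm N).toLp _) - u‖ ^ 2) atTop (𝓝 0) := by
    simp only [hnorm]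
    have := ((hasSum_sq_norm_modeCoeff u).comp tendsto_freqBox).const_sub (‖u‖ ^ 2)
    rwa [sub_self] at this
  have hlim' : Tendsto (fun N => ‖((hm N).toLp _) - u‖) atTop (𝓝 0) := by
    have := hlim.sqrt
    simpa only [Real.sqrt_sq (norm_nonneg _), Real.sqrt_zero] using this
  have hE := (ENNReal.continuous_ofReal.tendsto 0).comp hlim'
  rw [ENNReal.ofReal_zero] at hE
  refine hE.congr fun N => ?_
  rw [Function.comp_apply, ofReal_norm, Lp.enorm_def]
  refine eLpNorm_congr_ae ?_
  filter_upwards [Lp.coeFn_sub ((hm N).toLp _) u, (hm N).coeFn_toLp] with x h1 h2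
  rw [h1, Pi.sub_apply, h2]

/-! ### Symbols of gradients, divergences and Navier operators -/

theorem trigPoly_add (S : Finset (Fin 2 → ℤ)) (c d : (Fin 2 → ℤ) → ℂ) (x : Plane) :
    trigPoly S c x + trigPoly S d x = trigPoly S (fun k => c k + d k) x := by
  simp only [trigPoly, add_mul, Finset.sum_add_distrib, Complex.add_re]

theorem mul_trigPoly (r : ℝ) (S : Finset (Fin 2 → ℤ)) (c : (Fin 2 → ℤ) → ℂ) (x : Plane) :
    r * trigPoly S c x = trigPoly S (fun k => r * c k) x := by
  simp only [trigPoly, mul_assoc, ← Finset.mul_sum, Complex.re_ofReal_mul]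

theorem trigPoly_sub (S : Finset (Fin 2 → ℤ)) (c d : (Fin 2 → ℤ) → ℂ) (x : Plane) :
    trigPoly S c x - trigPoly S d x = trigPoly S (fun k => c k - d k) x := by
  simp only [trigPoly, sub_mul, Finset.sum_sub_distrib, Complex.sub_re]

/-- `G` and `D` act on trigonometric polynomials as Fourier multipliers with symbols `Λ` and `-Λ*`,
so that `D` is minus the adjoint of `G`. -/
structure HasSymbol (G : (Plane → ℝ) → Plane → Plane) (D : (Plane → Plane) → Plane → ℝ)
    (Λ : (Fin 2 → ℤ) → ModeSpace) : Prop where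
  grad : ∀ S c, G (trigPoly S c) = trigField S fun k => c k • Λ k
  div : ∀ S a, D (trigField S a) = trigPoly S fun k => -inner ℂ (Λ k) (a k)
  hermitian : ∀ k j, Λ (-k) j = conj (Λ k j)

/-- The symbol `a ↦ μ |Λ|² a + (λ + μ) ⟨Λ, a⟩ Λ` of the Navier operator at a frequency where the
gradient has symbol `Λ`. -/
def navierSymbol (lam mu : ℝ) (Λ : ModeSpace) : ModeSpace →L[ℝ] ModeSpace :=
  (mu * ‖Λ‖ ^ 2) • ContinuousLinearMap.id ℝ ModeSpace
    + (lam + mu) • ((innerSL ℂ Λ).smulRight Λ).restrictScalars ℝ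

theorem navierSymbol_apply (lam mu : ℝ) (Λ a : ModeSpace) :
    navierSymbol lam mu Λ a = (mu * ‖Λ‖ ^ 2) • a + (lam + mu) • (inner ℂ Λ a : ℂ) • Λ := rfl

theorem inner_real_eq_re_inner (a b : ModeSpace) : inner ℝ a b = (inner ℂ a b : ℂ).re := by
  rw [inner_modeSpace, PiLp.inner_apply]
  congr 1
  exact Finset.sum_congr rfl fun j _ => by rw [RCLike.inner_apply, mul_comm]

theorem inner_navierSymbol (lam mu : ℝ) (Λ a b : ModeSpace) :
    inner ℝ (navierSymbol lam mu Λ a) b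
      = mu * ‖Λ‖ ^ 2 * inner ℝ a b + (lam + mu) * (conj (inner ℂ Λ a : ℂ) * inner ℂ Λ b).re := by
  rw [navierSymbol_apply, inner_add_left, real_inner_smul_left, real_inner_smul_left,
    inner_real_eq_re_inner (_ • Λ) b, inner_smul_left]

theorem navierSymbol_symmetric (lam mu : ℝ) (Λ a b : ModeSpace) :
    inner ℝ (navierSymbol lam mu Λ a) b = inner ℝ a (navierSymbol lam mu Λ b) := by
  rw [← real_inner_comm a, inner_navierSymbol, inner_navierSymbol, real_inner_comm]
  congr 2
  rw [← Complex.conj_re, map_mul, Complex.conj_conj, mul_comm]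

theorem inner_navierSymbol_self (lam mu : ℝ) (Λ a : ModeSpace) :
    inner ℝ (navierSymbol lam mu Λ a) a
      = mu * (‖Λ‖ ^ 2 * ‖a‖ ^ 2) + (lam + mu) * ‖(inner ℂ Λ a : ℂ)‖ ^ 2 := by
  rw [inner_navierSymbol, real_inner_self_eq_norm_sq, mul_comm (conj _), Complex.mul_conj,
    Complex.normSq_eq_norm_sq, Complex.ofReal_re]
  ring

theorem norm_inner_sq_le (Λ a : ModeSpace) : ‖(inner ℂ Λ a : ℂ)‖ ^ 2 ≤ ‖Λ‖ ^ 2 * ‖a‖ ^ 2 := by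
  rw [← mul_pow]
  gcongr
  exact norm_inner_le_norm _ _

theorem navierSymbol_coercive (lam mu : ℝ) (Λ a : ModeSpace) :
    min mu (lam + 2 * mu) * (‖Λ‖ ^ 2 * ‖a‖ ^ 2) ≤ inner ℝ (navierSymbol lam mu Λ a) a := by
  rw [inner_navierSymbol_self]
  have h1 := norm_inner_sq_le Λ a
  have h2 : 0 ≤ ‖(inner ℂ Λ a : ℂ)‖ ^ 2 := by positivity
  have h3 := min_le_left mu (lam + 2 * mu)
  have h4 := min_le_right mu (lam + 2 * mu)
  nlinarith [mul_nonneg (sub_nonneg.2 h3) (sub_nonneg.2 h1), mul_nonneg (sub_nonneg.2 h4) h2]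

theorem inner_navierSymbol_self_le (lam mu : ℝ) (Λ a : ModeSpace) :
    inner ℝ (navierSymbol lam mu Λ a) a ≤ (|mu| + |lam + mu|) * (‖Λ‖ ^ 2 * ‖a‖ ^ 2) := by
  rw [inner_navierSymbol_self, add_mul |mu|]
  have h0 : 0 ≤ ‖Λ‖ ^ 2 * ‖a‖ ^ 2 := by positivity
  exact add_le_add (mul_le_mul_of_nonneg_right (le_abs_self mu) h0)
    (mul_le_mul (le_abs_self _) (norm_inner_sq_le Λ a) (sq_nonneg _) (abs_nonneg _))

theorem continuous_navierSymbol (lam mu : ℝ) : Continuous (navierSymbol lam mu) := by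
  have h : Continuous fun Λ : ModeSpace =>
      ((innerSL ℂ Λ).smulRight Λ).restrictScalars ℝ := by
    have h1 : Continuous fun Λ : ModeSpace => (innerSL ℂ Λ).smulRight Λ :=
      (ContinuousLinearMap.smulRightL ℂ ModeSpace ModeSpace).continuous₂.comp
        ((innerSL ℂ).continuous.prodMk continuous_id)
    exact (ContinuousLinearMap.restrictScalarsL ℂ ModeSpace ModeSpace ℝ ℝ).continuous.comp h1
  unfold navierSymbol
  exact (((continuous_const.mul (continuous_norm.pow 2))).smul continuous_const).add
    (h.const_smul (lam + mu))

theorem HasSymbol.navier_trigField {G : (Plane → ℝ) → Plane → Plane}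
    {D : (Plane → Plane) → Plane → ℝ} {Λ : (Fin 2 → ℤ) → ModeSpace} (h : HasSymbol G D Λ)
    (lam mu : ℝ) (S : Finset (Fin 2 → ℤ)) (a : (Fin 2 → ℤ) → ModeSpace) :
    navier G D lam mu (trigField S a) = trigField S fun k => navierSymbol lam mu (Λ k) (a k) := by
  ext x j
  have e1 : G (fun y => trigField S a y j) = trigField S fun k => a k j • Λ k := h.grad S _
  simp only [navier, e1, h.div, h.grad]
  simp only [trigField]
  rw [mul_trigPoly, mul_trigPoly, trigPoly_sub]
  congr 1
  ext k
  rw [navierSymbol_apply, inner_smul_right, inner_self_eq_norm_sq_to_K]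
  simp only [PiLp.add_apply, PiLp.smul_apply, Complex.real_smul, smul_eq_mul, Complex.coe_algebraMap]
  push_cast
  ring

/-! ### The local operators -/

/-- A frequency as a vector of the plane. -/
def freq (k : Fin 2 → ℤ) : Plane := WithLp.toLp 2 fun j => (k j : ℝ)

theorem character_eq (k : Fin 2 → ℤ) (x : Plane) :
    character k x = Complex.exp (Complex.I * ((inner ℝ (freq k) x : ℝ) : ℂ)) := by
  rw [character, PiLp.inner_apply]
  congr 4
  ext j
  rw [RCLike.inner_apply, conj_trivial, mul_comm]
  rfl

/-- The symbol `i k` of the local gradient. -/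
def localSymbol (k : Fin 2 → ℤ) : ModeSpace := WithLp.toLp 2 fun j => Complex.I * (k j : ℂ)

theorem norm_localSymbol (k : Fin 2 → ℤ) : ‖localSymbol k‖ = ‖freq k‖ := by
  rw [EuclideanSpace.norm_eq, EuclideanSpace.norm_eq]
  simp [localSymbol, freq]

theorem hasFDerivAt_character (k : Fin 2 → ℤ) (x : Plane) :
    HasFDerivAt (character k) (character k x •
      Complex.I • (Complex.ofRealCLM.comp (innerSL ℝ (freq k)))) x := by
  have h1 : HasFDerivAt (fun x : Plane => ((inner ℝ (freq k) x : ℝ) : ℂ))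
      (Complex.ofRealCLM.comp (innerSL ℝ (freq k))) x :=
    (Complex.ofRealCLM.comp (innerSL ℝ (freq k))).hasFDerivAt
  have h2 := (h1.const_mul Complex.I).cexp
  rw [← character_eq] at h2
  exact h2.congr_of_eventuallyEq (Eventually.of_forall (character_eq k))

theorem fderiv_trigPoly_single (S : Finset (Fin 2 → ℤ)) (c : (Fin 2 → ℤ) → ℂ) (x : Plane)
    (j : Fin 2) :
    fderiv ℝ (trigPoly S c) x (EuclideanSpace.single j 1)
      = trigPoly S (fun k => c k * localSymbol k j) x := by
  have h : HasFDerivAt (trigPoly S c) (Complex.reCLM.comp (∑ k ∈ S, c k • character k x •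
      Complex.I • (Complex.ofRealCLM.comp (innerSL ℝ (freq k))))) x :=
    Complex.reCLM.hasFDerivAt.comp x
      (HasFDerivAt.fun_sum fun k _ => (hasFDerivAt_character k x).const_mul (c k))
  rw [h.fderiv, trigPoly]
  simp only [ContinuousLinearMap.comp_apply, _root_.sum_apply,
    _root_.smul_apply, Complex.reCLM_apply, Complex.ofRealCLM_apply,
    innerSL_apply_apply, smul_eq_mul, EuclideanSpace.inner_single_right, conj_trivial, one_mul]
  congr 1
  refine Finset.sum_congr rfl fun k _ => ?_
  simp only [localSymbol, freq, Complex.ofReal_intCast]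
  ring

theorem hasSymbol_local : HasSymbol gradient localDiv localSymbol where
  grad S c := by
    ext x j
    have : gradient (trigPoly S c) x j
        = inner ℝ (gradient (trigPoly S c) x) (EuclideanSpace.single j 1) := by
      rw [EuclideanSpace.inner_single_right, conj_trivial, one_mul]
    rw [this, gradient, InnerProductSpace.toDual_symm_apply, fderiv_trigPoly_single]
    rfl
  div S a := by
    ext x
    have hd : ∀ i, DifferentiableAt ℝ (trigPoly S fun k => a k i) x := fun i =>
      (contDiff_trigPoly S _).differentiable (by simp) x
    have h : HasFDerivAt (trigField S a) (fderiv ℝ (trigField S a) x) x :=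
      ((contDiff_trigField S a).differentiable (by simp) x).hasFDerivAt
    have h2 : ∀ i v, fderiv ℝ (trigField S a) x v i = fderiv ℝ (trigPoly S fun k => a k i) x v := by
      intro i v
      have h3 := (PiLp.proj 2 (fun _ : Fin 2 => ℝ) i (𝕜 := ℝ)).hasFDerivAt.comp x h
      have h4 := h3.unique (hd i).hasFDerivAt
      rw [← h4]
      rfl
    simp only [localDiv, h2, fderiv_trigPoly_single, Fin.sum_univ_two]
    rw [trigPoly_add]
    congr 1
    ext k
    rw [PiLp.inner_apply, Fin.sum_univ_two]
    simp [localSymbol]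
    ring
  hermitian k j := by simp [localSymbol]

/-! ### The symbol of the nonlocal gradient -/

theorem scaledKernel_mul_norm {w : ℝ → ℝ} {δ : ℝ} (hδ : 0 < δ) (s : Plane) :
    scaledKernel w δ ‖s‖ * ‖s‖ = (δ ^ 2)⁻¹ * (w ‖δ⁻¹ • s‖ * ‖δ⁻¹ • s‖) := by
  rw [norm_smul, norm_inv, Real.norm_of_nonneg hδ.le, scaledKernel, inv_mul_eq_div]
  field_simp

theorem IsKernel.integrable_scaledKernel {w : ℝ → ℝ} (hw : IsKernel w) {δ : ℝ} (hδ : 0 < δ) :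
    Integrable fun s : Plane => scaledKernel w δ ‖s‖ * ‖s‖ := by
  simp only [scaledKernel_mul_norm hδ]
  exact (hw.integrable.comp_smul (inv_ne_zero hδ.ne')).const_mul _

/-- The singular weight `w_δ(|s|) / |s|` is integrable against functions of quadratic growth. -/
theorem IsKernel.integrable_div_norm_smul {w : ℝ → ℝ} (hw : IsKernel w) {δ : ℝ} (hδ : 0 < δ)
    {E : Type*} [NormedAddCommGroup E] [NormedSpace ℝ E] {b : Plane → E}
    (hb : AEStronglyMeasurable b volume) {C : ℝ} (hC : ∀ s, ‖b s‖ ≤ C * ‖s‖ ^ 2) :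
    Integrable fun s : Plane => (scaledKernel w δ ‖s‖ / ‖s‖) • b s := by
  have hC0 : ∀ s : Plane, ‖(‖s‖ ^ 2)⁻¹ • b s‖ ≤ |C| := by
    intro s
    by_cases hs : s = 0
    · simp [hs]
    · have : 0 < ‖s‖ := norm_pos_iff.2 hs
      rw [norm_smul, norm_inv, norm_pow, norm_norm, inv_mul_le_iff₀ (by positivity), mul_comm]
      exact (hC s).trans (mul_le_mul_of_nonneg_right (le_abs_self C) (by positivity))
  have h := (hw.integrable_scaledKernel hδ).smul_bdd |C|
    ((by fun_prop : Measurable fun s : Plane => (‖s‖ ^ 2)⁻¹).aestronglyMeasurable.smul hb)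
    (ae_of_all _ hC0)
  refine h.congr (ae_of_all _ fun s => ?_)
  simp only [Pi.smul_apply', smul_smul]
  congr 1
  by_cases hs : s = 0
  · simp [hs]
  · have : ‖s‖ ≠ 0 := norm_ne_zero_iff.2 hs
    field_simp

theorem measurable_halfPlane (n : Plane) : Measurable (halfPlane n) := by
  unfold halfPlane
  exact Measurable.ite (measurableSet_le measurable_const (by fun_prop)) measurable_const
    measurable_const

theorem norm_halfPlane_le (n z : Plane) : ‖halfPlane n z‖ ≤ 1 := by
  unfold halfPlane
  split_ifs <;> simp

theorem halfPlane_smul (n z : Plane) {δ : ℝ} (hδ : 0 < δ) :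
    halfPlane n (δ • z) = halfPlane n z := by
  unfold halfPlane
  simp only [real_inner_smul_left, mul_nonneg_iff_of_pos_left hδ]

theorem norm_coord_le (s : Plane) (j : Fin 2) : ‖s j‖ ≤ ‖s‖ := PiLp.norm_apply_le s j

theorem norm_character_sub_one_le (k : Fin 2 → ℤ) (s : Plane) :
    ‖character k s - 1‖ ≤ ‖freq k‖ * ‖s‖ := by
  rw [character_eq]
  exact Real.norm_exp_I_mul_ofReal_sub_one_le.trans (norm_inner_le_norm _ _)

/-- The symbol of the nonlocal gradient, the vector
`2 ∫ χ_n(s) w_δ(|s|) / |s| (exp(i k · s) - 1) s ds`. -/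
def nonlocalSymbol (w : ℝ → ℝ) (n : Plane) (δ : ℝ) (k : Fin 2 → ℤ) : ModeSpace :=
  WithLp.toLp 2 fun j => 2 * ∫ s : Plane,
    (scaledKernel w δ ‖s‖ / ‖s‖) • ((halfPlane n s * s j : ℝ) : ℂ) * (character k s - 1)

theorem IsKernel.integrable_symbol {w : ℝ → ℝ} (hw : IsKernel w) (n : Plane) {δ : ℝ} (hδ : 0 < δ)
    (k : Fin 2 → ℤ) (j : Fin 2) :
    Integrable fun s : Plane =>
      (scaledKernel w δ ‖s‖ / ‖s‖) • ((halfPlane n s * s j : ℝ) : ℂ) * (character k s - 1) := by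
  simp only [smul_mul_assoc]
  refine hw.integrable_div_norm_smul hδ (C := ‖freq k‖) ?_ fun s => ?_
  · have h1 := measurable_halfPlane n
    have h2 : Measurable (character k) := (continuous_character k).measurable
    exact (by fun_prop : Measurable fun s : Plane =>
      ((halfPlane n s * s j : ℝ) : ℂ) * (character k s - 1)).aestronglyMeasurable
  · rw [norm_mul, Complex.norm_real, norm_mul]
    calc ‖halfPlane n s‖ * ‖s j‖ * ‖character k s - 1‖ ≤ 1 * ‖s‖ * (‖freq k‖ * ‖s‖) := by
          gcongr
          · exact norm_halfPlane_le n s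
          · exact norm_coord_le s j
          · exact norm_character_sub_one_le k s
      _ = ‖freq k‖ * ‖s‖ ^ 2 := by ring

theorem trigPoly_add_arg_sub (S : Finset (Fin 2 → ℤ)) (c : (Fin 2 → ℤ) → ℂ) (x s : Plane) :
    trigPoly S c (s + x) - trigPoly S c x
      = (∑ k ∈ S, c k * character k x * (character k s - 1)).re := by
  rw [trigPoly, trigPoly, ← Complex.sub_re, ← Finset.sum_sub_distrib]
  congr 1
  refine Finset.sum_congr rfl fun k _ => ?_
  rw [character_add]
  ring

theorem IsKernel.nonlocalGrad_trigPoly {w : ℝ → ℝ} (hw : IsKernel w) (n : Plane) {δ : ℝ}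
    (hδ : 0 < δ) (S : Finset (Fin 2 → ℤ)) (c : (Fin 2 → ℤ) → ℂ) :
    nonlocalGrad w n δ (trigPoly S c) = trigField S fun k => c k • nonlocalSymbol w n δ k := by
  ext x j
  set F : Plane → Plane := fun s => (halfPlane n s * scaledKernel w δ ‖s‖ *
    ((trigPoly S c (s + x) - trigPoly S c x) / ‖s‖)) • s
  have hF : nonlocalGrad w n δ (trigPoly S c) x = (2 : ℝ) • ∫ s, F s := by
    rw [nonlocalGrad, ← integral_sub_right_eq_self F x]
    simp only [F, sub_add_cancel]
  set K : (Fin 2 → ℤ) → Fin 2 → Plane → ℂ := fun k i s =>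
    (scaledKernel w δ ‖s‖ / ‖s‖) • ((halfPlane n s * s i : ℝ) : ℂ) * (character k s - 1)
  have hFK : ∀ i s, F s i = (∑ k ∈ S, c k * character k x * K k i s).re := by
    intro i s
    have e : ∑ k ∈ S, c k * character k x * K k i s
        = ((scaledKernel w δ ‖s‖ / ‖s‖ * (halfPlane n s * s i) : ℝ) : ℂ) *
          ∑ k ∈ S, c k * character k x * (character k s - 1) := by
      rw [Finset.mul_sum]
      refine Finset.sum_congr rfl fun k _ => ?_
      simp only [K, Complex.real_smul, ← Complex.ofReal_mul]
      ring
    rw [e, Complex.re_ofReal_mul, ← trigPoly_add_arg_sub]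
    simp only [F, PiLp.smul_apply, smul_eq_mul]
    ring
  have hsum : ∀ i, Integrable fun s => ∑ k ∈ S, c k * character k x * K k i s := fun i =>
    integrable_finsetSum S fun k _ => (hw.integrable_symbol n hδ k i).const_mul _
  have hFi : ∀ i, Integrable (fun s => F s i) := fun i => by
    simp only [hFK]
    exact (hsum i).re
  rw [hF, PiLp.smul_apply, eval_integral_piLp hFi]
  simp only [hFK]
  have h := Complex.reCLM.integral_comp_comm (hsum j)
  simp only [Complex.reCLM_apply] at h
  rw [h, integral_finsetSum S fun k _ => (hw.integrable_symbol n hδ k j).const_mul _]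
  simp only [trigField, trigPoly, smul_eq_mul]
  rw [← Complex.re_ofReal_mul, Finset.mul_sum]
  congr 1
  refine Finset.sum_congr rfl fun k _ => ?_
  rw [integral_const_mul]
  simp only [nonlocalSymbol, PiLp.smul_apply, smul_eq_mul]
  push_cast
  ring

theorem IsKernel.nonlocalDiv_trigField {w : ℝ → ℝ} (hw : IsKernel w) (n : Plane) {δ : ℝ}
    (hδ : 0 < δ) (S : Finset (Fin 2 → ℤ)) (a : (Fin 2 → ℤ) → ModeSpace) :
    nonlocalDiv w n δ (trigField S a)
      = trigPoly S fun k => -inner ℂ (nonlocalSymbol w n δ k) (a k) := by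
  ext x
  set K : (Fin 2 → ℤ) → Fin 2 → Plane → ℂ := fun k i s =>
    (scaledKernel w δ ‖s‖ / ‖s‖) • ((halfPlane n s * s i : ℝ) : ℂ) * (character k s - 1)
  have hcharneg : ∀ k s, character k (-s) = conj (character k s) := fun k s => by
    rw [← character_neg_left, character_eq, character_eq]
    congr 2
    rw [inner_neg_right]
    have : freq (-k) = -freq k := by ext i; simp [freq]
    rw [this, inner_neg_left]
  have hint : ∀ s, halfPlane n s * (scaledKernel w δ ‖s‖ / ‖s‖) *
      inner ℝ s (trigField S a x - trigField S a (x - s))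
      = (∑ j, ∑ k ∈ S, -(a k j * character k x) * conj (K k j s)).re := by
    intro s
    rw [PiLp.inner_apply, Finset.mul_sum, Complex.re_sum]
    refine Finset.sum_congr rfl fun j _ => ?_
    have e : ∑ k ∈ S, -(a k j * character k x) * conj (K k j s)
        = -(((scaledKernel w δ ‖s‖ / ‖s‖ * (halfPlane n s * s j) : ℝ) : ℂ) *
          ∑ k ∈ S, a k j * character k x * (character k (-s) - 1)) := by
      rw [Finset.mul_sum, ← Finset.sum_neg_distrib]
      refine Finset.sum_congr rfl fun k _ => ?_
      simp only [K, Complex.real_smul, map_mul, map_sub, map_one, Complex.conj_ofReal,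
        hcharneg, Complex.ofReal_mul]
      ring
    rw [e, Complex.neg_re, Complex.re_ofReal_mul, ← trigPoly_add_arg_sub S (fun k => a k j)]
    rw [neg_add_eq_sub]
    simp only [PiLp.sub_apply, trigField, RCLike.inner_apply, conj_trivial]
    ring
  have hK : ∀ k j, Integrable fun s => conj (K k j s) := fun k j =>
    (Complex.conjLIE.integrable_comp_iff).2 (hw.integrable_symbol n hδ k j)
  have hk : ∀ j k, Integrable fun s => -(a k j * character k x) * conj (K k j s) := fun j k =>
    (hK k j).const_mul _
  have hj : ∀ j, Integrable fun s => ∑ k ∈ S, -(a k j * character k x) * conj (K k j s) := fun j =>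
    integrable_finsetSum S fun k _ => hk j k
  have h := Complex.reCLM.integral_comp_comm (integrable_finsetSum Finset.univ fun j _ => hj j)
  simp only [Complex.reCLM_apply] at h
  rw [nonlocalDiv]
  simp only [hint]
  rw [h, integral_finsetSum _ fun j _ => hj j, ← Complex.re_ofReal_mul, trigPoly]
  congr 1
  simp only [integral_finsetSum S fun k _ => hk _ k]
  rw [Finset.sum_comm, Finset.mul_sum]
  refine Finset.sum_congr rfl fun k _ => ?_
  rw [PiLp.inner_apply, Finset.mul_sum, neg_mul, Finset.sum_mul, ← Finset.sum_neg_distrib]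
  refine Finset.sum_congr rfl fun j _ => ?_
  rw [integral_const_mul, integral_conj]
  simp only [nonlocalSymbol, RCLike.inner_apply, map_mul, map_ofNat, K]
  push_cast
  ring

theorem IsKernel.hasSymbol_nonlocal {w : ℝ → ℝ} (hw : IsKernel w) (n : Plane) {δ : ℝ}
    (hδ : 0 < δ) :
    HasSymbol (nonlocalGrad w n δ) (nonlocalDiv w n δ) (nonlocalSymbol w n δ) where
  grad := hw.nonlocalGrad_trigPoly n hδ
  div := hw.nonlocalDiv_trigField n hδ
  hermitian k j := by
    simp only [nonlocalSymbol, map_mul, map_ofNat, ← integral_conj, character_neg_left,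
      Complex.real_smul, map_sub, map_one, Complex.conj_ofReal]

/-! ### The local limit of the nonlocal symbol -/

/-- Rescaling moves the horizon `δ` from the kernel into a difference quotient. -/
theorem nonlocalSymbol_eq_rescaled (w : ℝ → ℝ) (n : Plane) {δ : ℝ} (hδ : 0 < δ) (k : Fin 2 → ℤ)
    (j : Fin 2) :
    nonlocalSymbol w n δ k j = 2 * ∫ z : Plane,
      (scaledKernel w 1 ‖z‖ / ‖z‖) • ((halfPlane n z * z j : ℝ) : ℂ) *
        ((character k (δ • z) - 1) / δ) := by
  set f : Plane → ℂ := fun s =>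
    (scaledKernel w δ ‖s‖ / ‖s‖) • ((halfPlane n s * s j : ℝ) : ℂ) * (character k s - 1)
  have h := Measure.integral_comp_smul (volume : Measure Plane) f δ
  rw [finrank_euclideanSpace_fin, abs_of_pos (by positivity)] at h
  have h2 : ∫ s, f s = (δ ^ 2) • ∫ z, f (δ • z) := by
    rw [h, smul_smul, mul_inv_cancel₀ (by positivity), one_smul]
  change 2 * ∫ s, f s = _
  rw [h2, ← integral_smul]
  congr 2
  ext z
  simp only [f, norm_smul, Real.norm_of_nonneg hδ.le, halfPlane_smul n z hδ, PiLp.smul_apply,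
    smul_eq_mul, Complex.real_smul, scaledKernel]
  rw [mul_div_cancel_left₀ _ hδ.ne']
  have : (δ : ℂ) ≠ 0 := by exact_mod_cast hδ.ne'
  push_cast
  by_cases hz : z = 0
  · simp [hz]
  · have : (‖z‖ : ℂ) ≠ 0 := by simpa using hz
    field_simp

/-- The integrand of the rescaled symbol is dominated by the first moment density. -/
theorem IsKernel.norm_rescaled_le {w : ℝ → ℝ} (hw : IsKernel w) (n : Plane) {δ : ℝ} (hδ : 0 < δ)
    (k : Fin 2 → ℤ) (j : Fin 2) (z : Plane) :
    ‖(scaledKernel w 1 ‖z‖ / ‖z‖) • ((halfPlane n z * z j : ℝ) : ℂ) *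
        ((character k (δ • z) - 1) / δ)‖ ≤ ‖freq k‖ * (w ‖z‖ * ‖z‖) := by
  by_cases hz : z = 0
  · simp [hz]
  have hz' : 0 < ‖z‖ := norm_pos_iff.2 hz
  have hwz := hw.nonneg _ hz'
  have h1 : ‖(character k (δ • z) - 1) / (δ : ℂ)‖ ≤ ‖freq k‖ * ‖z‖ := by
    rw [norm_div, Complex.norm_real, Real.norm_of_nonneg hδ.le, div_le_iff₀ hδ]
    refine (norm_character_sub_one_le k _).trans (le_of_eq ?_)
    rw [norm_smul, Real.norm_of_nonneg hδ.le]
    ring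
  have h2 : ‖(scaledKernel w 1 ‖z‖ / ‖z‖) • ((halfPlane n z * z j : ℝ) : ℂ)‖ ≤ w ‖z‖ := by
    rw [norm_smul, Complex.norm_real, norm_mul, norm_div, norm_norm, scaledKernel]
    simp only [one_pow, div_one, one_mul, Real.norm_of_nonneg hwz]
    calc w ‖z‖ / ‖z‖ * (‖halfPlane n z‖ * ‖z j‖) ≤ w ‖z‖ / ‖z‖ * (1 * ‖z‖) := by
          gcongr
          · exact norm_halfPlane_le n z
          · exact norm_coord_le z j
      _ = w ‖z‖ := by field_simp
  rw [norm_mul]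
  calc _ ≤ w ‖z‖ * (‖freq k‖ * ‖z‖) := mul_le_mul h2 h1 (norm_nonneg _) hwz
    _ = _ := by ring

theorem IsKernel.norm_sq_nonlocalSymbol_le {w : ℝ → ℝ} (hw : IsKernel w) (n : Plane) {δ : ℝ}
    (hδ : 0 < δ) (k : Fin 2 → ℤ) : ‖nonlocalSymbol w n δ k‖ ^ 2 ≤ 32 * ‖freq k‖ ^ 2 := by
  have h : ∀ j, ‖nonlocalSymbol w n δ k j‖ ≤ 4 * ‖freq k‖ := by
    intro j
    rw [nonlocalSymbol_eq_rescaled w n hδ, norm_mul, Complex.norm_ofNat]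
    have := norm_integral_le_of_norm_le (hw.integrable.const_mul ‖freq k‖)
      (ae_of_all _ (hw.norm_rescaled_le n hδ k j))
    rw [integral_const_mul, hw.moment] at this
    linarith
  rw [EuclideanSpace.norm_sq_eq, Fin.sum_univ_two]
  nlinarith [h 0, h 1, norm_nonneg (nonlocalSymbol w n δ k 0), norm_nonneg (nonlocalSymbol w n δ k 1)]

/-- The rotation of the plane by a right angle. -/
def quarterTurn : Plane ≃ₗᵢ[ℝ] Plane where
  toFun z := !₂[-z 1, z 0]
  invFun z := !₂[z 1, -z 0]
  map_add' x y := by ext i; fin_cases i <;> simp [add_comm]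
  map_smul' r x := by ext i; fin_cases i <;> simp
  left_inv z := by ext i; fin_cases i <;> simp
  right_inv z := by ext i; fin_cases i <;> simp
  norm_map' z := by
    rw [EuclideanSpace.norm_eq, EuclideanSpace.norm_eq]
    simp [Fin.sum_univ_two, add_comm]

theorem quarterTurn_apply (z : Plane) : quarterTurn z = !₂[-z 1, z 0] := rfl

theorem volume_boundary_halfPlane {n : Plane} (hn : ‖n‖ = 1) :
    volume {z : Plane | inner ℝ z n = 0} = 0 := by
  have h := Measure.addHaar_submodule (volume : Measure Plane) (ℝ ∙ n)ᗮ (by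
    intro h
    have h1 : n ∈ (ℝ ∙ n)ᗮ := by rw [h]; trivial
    rw [Submodule.mem_orthogonal_singleton_iff_inner_right, real_inner_self_eq_norm_sq, hn] at h1
    norm_num at h1)
  convert h using 2
  ext z
  simp only [Set.mem_ofPred_eq, SetLike.mem_coe, Submodule.mem_orthogonal_singleton_iff_inner_left]

/-- An even function has half of its integral on each half-plane. -/
theorem two_mul_integral_halfPlane_mul {n : Plane} (hn : ‖n‖ = 1) {f : Plane → ℝ}
    (hf : Integrable f) (heven : ∀ z, f (-z) = f z) :
    2 * ∫ z, halfPlane n z * f z = ∫ z, f z := by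
  have hi : ∀ g : Plane → Plane, Measurable g → Integrable fun z => halfPlane n (g z) * f z :=
    fun g hg => hf.bdd_mul (c := 1) ((measurable_halfPlane n).comp hg).aestronglyMeasurable
      (ae_of_all _ fun z => norm_halfPlane_le n _)
  have h1 : ∫ z, halfPlane n z * f z = ∫ z, halfPlane n (-z) * f z := by
    rw [← integral_neg_eq_self]
    simp only [heven]
  rw [two_mul]
  nth_rewrite 2 [h1]
  rw [← integral_add (hi (fun z => z) measurable_id) (hi (fun z => -z) measurable_neg)]
  refine integral_congr_ae ?_
  have hae : ∀ᵐ z : Plane, inner ℝ z n ≠ 0 := by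
    rw [ae_iff]
    simpa using volume_boundary_halfPlane hn
  filter_upwards [hae] with z hz
  rw [← add_mul, halfPlane, halfPlane, inner_neg_left]
  rcases lt_or_gt_of_ne hz with h | h
  · rw [if_neg (by linarith), if_pos (by linarith)]; ring
  · rw [if_pos (by linarith), if_neg (by linarith)]; ring

/-- Isotropy of the second moments: they are unchanged by a quarter turn, and their trace is the
first moment of `w`. -/
theorem IsKernel.second_moment {w : ℝ → ℝ} (hw : IsKernel w) (i j : Fin 2) :
    ∫ z : Plane, scaledKernel w 1 ‖z‖ / ‖z‖ * (z i * z j) = if i = j then 1 else 0 := by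
  have hint : ∀ i j : Fin 2,
      Integrable fun z : Plane => scaledKernel w 1 ‖z‖ / ‖z‖ * (z i * z j) := fun i j =>
    hw.integrable_div_norm_smul one_pos (C := 1) (by fun_prop : Measurable fun z : Plane =>
      z i * z j).aestronglyMeasurable fun z => by
        rw [norm_mul, one_mul, sq]
        exact mul_le_mul (norm_coord_le z i) (norm_coord_le z j) (norm_nonneg _) (norm_nonneg _)
  have hrot : ∀ i j : Fin 2, ∫ z : Plane, scaledKernel w 1 ‖z‖ / ‖z‖ * (z i * z j)
      = ∫ z : Plane, scaledKernel w 1 ‖z‖ / ‖z‖ * (quarterTurn z i * quarterTurn z j) := by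
    intro i j
    have := quarterTurn.measurePreserving.integral_comp
      quarterTurn.toHomeomorph.measurableEmbedding
      fun z : Plane => scaledKernel w 1 ‖z‖ / ‖z‖ * (z i * z j)
    rw [← this]
    simp only [LinearIsometryEquiv.norm_map]
  have h01 : ∫ z : Plane, scaledKernel w 1 ‖z‖ / ‖z‖ * (z 0 * z 1) = 0 := by
    have h := hrot 0 1
    simp only [quarterTurn_apply] at h
    have e : ∀ z : Plane, scaledKernel w 1 ‖z‖ / ‖z‖ *
        ((!₂[-z 1, z 0] : Plane) 0 * (!₂[-z 1, z 0] : Plane) 1)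
        = -(scaledKernel w 1 ‖z‖ / ‖z‖ * (z 0 * z 1)) := fun z => by
      change scaledKernel w 1 ‖z‖ / ‖z‖ * (-z 1 * z 0) = _
      ring
    simp only [e] at h
    rw [integral_neg] at h
    linarith
  have h00 : ∫ z : Plane, scaledKernel w 1 ‖z‖ / ‖z‖ * (z 0 * z 0)
      = ∫ z : Plane, scaledKernel w 1 ‖z‖ / ‖z‖ * (z 1 * z 1) := by
    have h := hrot 0 0
    simp only [quarterTurn_apply] at h
    have e : ∀ z : Plane, scaledKernel w 1 ‖z‖ / ‖z‖ *
        ((!₂[-z 1, z 0] : Plane) 0 * (!₂[-z 1, z 0] : Plane) 0)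
        = scaledKernel w 1 ‖z‖ / ‖z‖ * (z 1 * z 1) := fun z => by
      simp
    simp only [e] at h
    exact h
  have htr : (∫ z : Plane, scaledKernel w 1 ‖z‖ / ‖z‖ * (z 0 * z 0))
      + ∫ z : Plane, scaledKernel w 1 ‖z‖ / ‖z‖ * (z 1 * z 1) = 2 := by
    rw [← integral_add (hint 0 0) (hint 1 1), ← hw.moment]
    congr 1
    ext z
    have hz := EuclideanSpace.real_norm_sq_eq z
    rw [Fin.sum_univ_two] at hz
    rw [← mul_add, ← sq, ← sq, ← hz, scaledKernel]
    by_cases h : z = 0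
    · simp [h]
    · have : ‖z‖ ≠ 0 := norm_ne_zero_iff.2 h
      field_simp
  fin_cases i <;> fin_cases j
  · simp; linarith
  · simpa using h01
  · have e : ∀ z : Plane, z 1 * z 0 = z 0 * z 1 := fun z => mul_comm _ _
    simpa [e] using h01
  · simp; linarith

theorem tendsto_character_sub_one_div (k : Fin 2 → ℤ) (z : Plane) :
    Tendsto (fun δ : ℝ => (character k (δ • z) - 1) / (δ : ℂ)) (𝓝[>] 0)
      (𝓝 (Complex.I * ((inner ℝ (freq k) z : ℝ) : ℂ))) := by
  have h1 : HasDerivAt (fun δ : ℝ => character k (δ • z))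
      (Complex.I * ((inner ℝ (freq k) z : ℝ) : ℂ)) 0 := by
    have h2 : HasDerivAt (fun δ : ℝ => δ • z) ((1 : ℝ) • z) 0 := (hasDerivAt_id 0).smul_const z
    have h3 := (hasFDerivAt_character k ((0 : ℝ) • z)).comp_hasDerivAt 0 h2
    refine h3.congr_deriv ?_
    simp [character]
  have h4 := h1.tendsto_slope_zero_right
  refine h4.congr fun δ => ?_
  simp [character, div_eq_inv_mul]

theorem IsKernel.tendsto_nonlocalSymbol {w : ℝ → ℝ} (hw : IsKernel w) {n : Plane} (hn : ‖n‖ = 1)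
    (k : Fin 2 → ℤ) :
    Tendsto (fun δ => nonlocalSymbol w n δ k) (𝓝[>] 0) (𝓝 (localSymbol k)) := by
  have hcoord : ∀ j, Tendsto (fun δ => nonlocalSymbol w n δ k j) (𝓝[>] 0)
      (𝓝 (localSymbol k j)) := by
    intro j
    have hlim : Tendsto (fun δ : ℝ => ∫ z : Plane,
        (scaledKernel w 1 ‖z‖ / ‖z‖) • ((halfPlane n z * z j : ℝ) : ℂ) *
          ((character k (δ • z) - 1) / δ)) (𝓝[>] 0)
        (𝓝 (∫ z : Plane, (scaledKernel w 1 ‖z‖ / ‖z‖) • ((halfPlane n z * z j : ℝ) : ℂ) *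
          (Complex.I * ((inner ℝ (freq k) z : ℝ) : ℂ)))) := by
      refine tendsto_integral_filter_of_dominated_convergence
        (fun z => ‖freq k‖ * (w ‖z‖ * ‖z‖)) ?_ ?_ (hw.integrable.const_mul _) ?_
      · filter_upwards [self_mem_nhdsWithin] with δ hδ
        have hδ : 0 < δ := hδ
        refine Integrable.aestronglyMeasurable ?_
        simp only [smul_mul_assoc]
        refine hw.integrable_div_norm_smul one_pos (C := ‖freq k‖) ?_ fun z => ?_
        · have h1 := measurable_halfPlane n
          have h2 : Measurable (character k) := (continuous_character k).measurable
          exact (by fun_prop : Measurable fun z : Plane =>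
            ((halfPlane n z * z j : ℝ) : ℂ) * ((character k (δ • z) - 1) / (δ : ℂ))).aestronglyMeasurable
        · rw [norm_mul, Complex.norm_real, norm_mul, norm_div, Complex.norm_real,
            Real.norm_of_nonneg hδ.le]
          have h3 : ‖character k (δ • z) - 1‖ / δ ≤ ‖freq k‖ * ‖z‖ := by
            rw [div_le_iff₀ hδ]
            refine (norm_character_sub_one_le k _).trans (le_of_eq ?_)
            rw [norm_smul, Real.norm_of_nonneg hδ.le]
            ring
          calc _ ≤ 1 * ‖z‖ * (‖freq k‖ * ‖z‖) := by
                gcongr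
                · exact norm_halfPlane_le n z
                · exact norm_coord_le z j
            _ = _ := by ring
      · filter_upwards [self_mem_nhdsWithin] with δ hδ
        exact ae_of_all _ (hw.norm_rescaled_le n hδ k j)
      · exact ae_of_all _ fun z => (tendsto_character_sub_one_div k z).const_mul _
    have hval : 2 * ∫ z : Plane, (scaledKernel w 1 ‖z‖ / ‖z‖) • ((halfPlane n z * z j : ℝ) : ℂ) *
          (Complex.I * ((inner ℝ (freq k) z : ℝ) : ℂ)) = localSymbol k j := by
      have hint : ∀ i, Integrable fun z : Plane => scaledKernel w 1 ‖z‖ / ‖z‖ * (z j * z i) :=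
        fun i => hw.integrable_div_norm_smul one_pos (C := 1) (by fun_prop : Measurable
          fun z : Plane => z j * z i).aestronglyMeasurable fun z => by
            rw [norm_mul, one_mul, sq]
            exact mul_le_mul (norm_coord_le z j) (norm_coord_le z i) (norm_nonneg _) (norm_nonneg _)
      have e : ∀ z : Plane, (scaledKernel w 1 ‖z‖ / ‖z‖) • ((halfPlane n z * z j : ℝ) : ℂ) *
          (Complex.I * ((inner ℝ (freq k) z : ℝ) : ℂ))
          = Complex.I * ((halfPlane n z * ∑ i, (k i : ℝ) *
            (scaledKernel w 1 ‖z‖ / ‖z‖ * (z j * z i)) : ℝ) : ℂ) := by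
        intro z
        rw [PiLp.inner_apply]
        simp only [Fin.sum_univ_two, RCLike.inner_apply, conj_trivial, freq, Complex.real_smul]
        push_cast
        ring
      have hsum : Integrable fun z : Plane => ∑ i, (k i : ℝ) *
          (scaledKernel w 1 ‖z‖ / ‖z‖ * (z j * z i)) :=
        integrable_finsetSum _ fun i _ => (hint i).const_mul _
      have h2 := two_mul_integral_halfPlane_mul hn hsum fun z => by simp
      rw [integral_finsetSum _ fun i _ => (hint i).const_mul _] at h2
      simp only [integral_const_mul, hw.second_moment, mul_ite, mul_one, mul_zero,
        Finset.sum_ite_eq, Finset.mem_univ, if_true] at h2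
      simp only [e]
      rw [integral_const_mul, integral_complex_ofReal, mul_left_comm]
      simp only [localSymbol]
      rw [← Complex.ofReal_intCast, ← h2]
      push_cast
      rfl
    rw [← hval]
    refine (hlim.const_mul 2).congr' ?_
    filter_upwards [self_mem_nhdsWithin] with δ hδ
    exact (nonlocalSymbol_eq_rescaled w n hδ k j).symm
  have h := tendsto_pi_nhds.2 hcoord
  exact ((PiLp.continuous_toLp 2 _).tendsto _).comp h

/-! ### The nonlocal energy in Fourier variables -/

/-- The elastic energy density of the Fourier coefficient `a` at a frequency where the gradient
has symbol `Λ`. -/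
def modeEnergy (lam mu : ℝ) (Λ a : ModeSpace) : ℝ :=
  1 / 2 * lam * ‖(inner ℂ Λ a : ℂ)‖ ^ 2
    + mu * ∑ i, ∑ j, ‖((1 / 2 : ℝ) : ℂ) * (a j * Λ i + a i * Λ j)‖ ^ 2

theorem modeEnergy_smul (lam mu r : ℝ) (Λ a : ModeSpace) :
    modeEnergy lam mu Λ (r • a) = r ^ 2 * modeEnergy lam mu Λ a := by
  have h1 : (inner ℂ Λ (r • a) : ℂ) = r * inner ℂ Λ a := by
    rw [← Complex.coe_smul, inner_smul_right]
  have h2 : ∀ i j, ((1 / 2 : ℝ) : ℂ) * ((r • a) j * Λ i + (r • a) i * Λ j)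
      = r * (((1 / 2 : ℝ) : ℂ) * (a j * Λ i + a i * Λ j)) := fun i j => by
    simp only [PiLp.smul_apply, Complex.real_smul]; ring
  simp only [modeEnergy, h1, h2]
  simp only [norm_mul (r : ℂ), Complex.norm_real, mul_pow, Real.norm_eq_abs r, sq_abs,
    ← Finset.mul_sum]
  ring

theorem abs_modeEnergy_le (lam mu : ℝ) (Λ a : ModeSpace) :
    |modeEnergy lam mu Λ a| ≤ (|lam| + |mu|) * (‖Λ‖ ^ 2 * ‖a‖ ^ 2) := by
  have h1 := norm_inner_sq_le Λ a
  have h2 : ∑ i, ∑ j, ‖((1 / 2 : ℝ) : ℂ) * (a j * Λ i + a i * Λ j)‖ ^ 2 ≤ ‖Λ‖ ^ 2 * ‖a‖ ^ 2 := by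
    have hb : ∀ i j, ‖((1 / 2 : ℝ) : ℂ) * (a j * Λ i + a i * Λ j)‖ ^ 2
        ≤ 1 / 2 * (‖a j‖ ^ 2 * ‖Λ i‖ ^ 2 + ‖a i‖ ^ 2 * ‖Λ j‖ ^ 2) := by
      intro i j
      have h := norm_add_le (a j * Λ i) (a i * Λ j)
      rw [norm_mul (a j), norm_mul (a i)] at h
      rw [norm_mul, Complex.norm_real, Real.norm_of_nonneg (by norm_num : (0 : ℝ) ≤ 1 / 2)]
      nlinarith [sq_nonneg (‖a j‖ * ‖Λ i‖ - ‖a i‖ * ‖Λ j‖), norm_nonneg (a j * Λ i + a i * Λ j)]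
    refine (Finset.sum_le_sum fun i _ => Finset.sum_le_sum fun j _ => hb i j).trans (le_of_eq ?_)
    rw [EuclideanSpace.norm_sq_eq, EuclideanSpace.norm_sq_eq]
    simp only [Fin.sum_univ_two]
    ring
  have h3 : 0 ≤ ∑ i, ∑ j, ‖((1 / 2 : ℝ) : ℂ) * (a j * Λ i + a i * Λ j)‖ ^ 2 := by positivity
  have h4 : 0 ≤ ‖Λ‖ ^ 2 * ‖a‖ ^ 2 := by positivity
  rw [modeEnergy]
  refine (abs_add_le _ _).trans ?_
  rw [abs_mul, abs_mul, abs_mul, abs_of_nonneg h3, abs_of_nonneg (sq_nonneg ‖(inner ℂ Λ a : ℂ)‖),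
    abs_of_pos (by norm_num : (0 : ℝ) < 1 / 2), add_mul]
  have h5 := mul_le_mul_of_nonneg_left h1 (abs_nonneg lam)
  have h6 := mul_le_mul_of_nonneg_left h2 (abs_nonneg mu)
  have h7 := mul_nonneg (abs_nonneg lam) h4
  nlinarith

theorem IsKernel.energy_trigField {w : ℝ → ℝ} (hw : IsKernel w) (n : Plane) {δ : ℝ} (hδ : 0 < δ)
    (lam mu : ℝ) {S : Finset (Fin 2 → ℤ)} {a : (Fin 2 → ℤ) → ModeSpace}
    (hS : ∀ k ∈ S, -k ∈ S) (ha : ∀ k j, a (-k) j = conj (a k j)) :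
    energy w n δ lam mu (trigField S a)
      = (2 * π) ^ 2 * ∑ k ∈ S, modeEnergy lam mu (nonlocalSymbol w n δ k) (a k) := by
  have hΛ := hw.hasSymbol_nonlocal n hδ
  set Λ := nonlocalSymbol w n δ
  have hdiv : ∫ x in cell, nonlocalDiv w n δ (trigField S a) x ^ 2
      = (2 * π) ^ 2 * ∑ k ∈ S, ‖(inner ℂ (Λ k) (a k) : ℂ)‖ ^ 2 := by
    rw [hΛ.div, integral_sq_trigPoly hS]
    · simp only [norm_neg]
    · intro k
      simp only [PiLp.inner_apply, RCLike.inner_apply, map_neg, map_sum, map_mul, hΛ.hermitian, ha]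
  have hst : ∀ i j x, strain w n δ (trigField S a) x i j
      = trigPoly S (fun k => ((1 / 2 : ℝ) : ℂ) * (a k j * Λ k i + a k i * Λ k j)) x := by
    intro i j x
    have e : ∀ j, nonlocalGrad w n δ (fun y => trigField S a y j)
        = trigField S fun k => a k j • Λ k := fun j => hΛ.grad S fun k => a k j
    simp only [strain, e]
    rw [div_eq_inv_mul]
    simp only [trigField]
    rw [trigPoly_add, mul_trigPoly]
    simp only [PiLp.smul_apply, smul_eq_mul, one_div]
  have hint : ∀ i j, ∫ x in cell, strain w n δ (trigField S a) x i j ^ 2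
      = (2 * π) ^ 2 * ∑ k ∈ S, ‖((1 / 2 : ℝ) : ℂ) * (a k j * Λ k i + a k i * Λ k j)‖ ^ 2 := by
    intro i j
    simp only [hst]
    refine integral_sq_trigPoly hS fun k => ?_
    simp only [map_mul, map_add, Complex.conj_ofReal, ha, hΛ.hermitian]
  have hi : ∀ i j, Integrable (fun x => strain w n δ (trigField S a) x i j ^ 2)
      (volume.restrict cell) := by
    intro i j
    simp only [hst]
    exact (memLp_trigPoly S _ 2).integrable_sq
  rw [energy, hdiv, integral_finsetSum _ fun i _ => integrable_finsetSum _ fun j _ => hi i j]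
  simp only [integral_finsetSum Finset.univ fun j _ => hi _ j, hint, modeEnergy]
  simp only [Finset.sum_add_distrib, ← Finset.mul_sum]
  have hcomm : ∑ k ∈ S, ∑ i, ∑ j, ‖((1 / 2 : ℝ) : ℂ) * (a k j * Λ k i + a k i * Λ k j)‖ ^ 2
      = ∑ i, ∑ j, ∑ k ∈ S, ‖((1 / 2 : ℝ) : ℂ) * (a k j * Λ k i + a k i * Λ k j)‖ ^ 2 := by
    rw [Finset.sum_comm]
    exact Finset.sum_congr rfl fun i _ => Finset.sum_comm
  rw [hcomm]
  ring

theorem trigPoly_eq_of_subset {S S' : Finset (Fin 2 → ℤ)} (h : S ⊆ S') (c : (Fin 2 → ℤ) → ℂ)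
    (x : Plane) : trigPoly S c x = trigPoly S' (fun k => if k ∈ S then c k else 0) x := by
  rw [trigPoly, trigPoly]
  simp only [ite_mul, zero_mul, Finset.sum_ite_mem, Finset.inter_eq_right.2 h]

theorem neg_mem_freqBox_iff {N : ℕ} {k : Fin 2 → ℤ} : -k ∈ freqBox N ↔ k ∈ freqBox N :=
  ⟨fun h => by simpa using neg_mem_freqBox _ h, neg_mem_freqBox k⟩

theorem trigField_sub_trigField (S S' : Finset (Fin 2 → ℤ)) (a : (Fin 2 → ℤ) → ModeSpace) :
    (fun x => trigField S a x - trigField S' a x) = trigField (S ∪ S') fun k =>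
      ((if k ∈ S then 1 else 0) - (if k ∈ S' then 1 else 0) : ℝ) • a k := by
  ext x j
  simp only [PiLp.sub_apply, trigField]
  rw [trigPoly_eq_of_subset Finset.subset_union_left (S' := S ∪ S'),
    trigPoly_eq_of_subset (S := S') Finset.subset_union_right (S' := S ∪ S'), trigPoly_sub]
  congr 1
  ext k
  simp only [PiLp.smul_apply, Complex.real_smul]
  split_ifs <;> simp

/-- A zero-mean field whose Fourier coefficients are square-summable with the weight `|Λ_δ(k)|²`
has finite energy: its Fourier truncations are Cauchy for the energy. -/
theorem IsKernel.hasEnergy_of_summable {w : ℝ → ℝ} (hw : IsKernel w) (n : Plane) {δ : ℝ}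
    (hδ : 0 < δ) (lam mu : ℝ) {v : L2} (hv : modeCoeff 0 v = 0)
    (hs : Summable fun k => ‖nonlocalSymbol w n δ k‖ ^ 2 * ‖modeCoeff k v‖ ^ 2) :
    HasEnergy w n δ lam mu v
      (∑' k, modeEnergy lam mu (nonlocalSymbol w n δ k) (modeCoeff k v)) := by
  set Λ := nonlocalSymbol w n δ
  set a : (Fin 2 → ℤ) → ModeSpace := fun k => (2 * π)⁻¹ • modeCoeff k v
  have ha : ∀ k j, a (-k) j = conj (a k j) := fun k j => by
    simp only [a, PiLp.smul_apply, modeCoeff_neg, Complex.real_smul, map_mul, Complex.conj_ofReal]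
  have hpi : (2 * π) ^ 2 ≠ 0 := by positivity
  have hsum : Summable fun k => modeEnergy lam mu (Λ k) (modeCoeff k v) :=
    Summable.of_norm_bounded (hs.mul_left (|lam| + |mu|)) fun k => abs_modeEnergy_le _ _ _ _
  refine ⟨fourierTruncation v, isTestField_fourierTruncation hv,
    tendsto_eLpNorm_fourierTruncation_sub v, ?_, ?_⟩
  · set t : (Fin 2 → ℤ) → ℝ := fun k => ‖Λ k‖ ^ 2 * ‖modeCoeff k v‖ ^ 2
    have ht0 : ∀ k, 0 ≤ t k := fun k => by positivity
    have hbound : ∀ p : ℕ × ℕ, |energy w n δ lam mu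
        (fun x => fourierTruncation v p.1 x - fourierTruncation v p.2 x)|
        ≤ (|lam| + |mu|) * ((∑' k, t k - ∑ k ∈ freqBox p.1, t k)
          + (∑' k, t k - ∑ k ∈ freqBox p.2, t k)) := by
      intro p
      set ε : (Fin 2 → ℤ) → ℝ := fun k =>
        (if k ∈ freqBox p.1 then 1 else 0) - (if k ∈ freqBox p.2 then 1 else 0)
      set S := freqBox p.1 ∪ freqBox p.2
      have e1 : (fun x => fourierTruncation v p.1 x - fourierTruncation v p.2 x)
          = trigField S fun k => ε k • a k := trigField_sub_trigField _ _ _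
      rw [e1, hw.energy_trigField n hδ]
      · have e2 : ∀ k, modeEnergy lam mu (nonlocalSymbol w n δ k) (ε k • a k)
            = ((2 * π) ^ 2)⁻¹ * (ε k ^ 2 * modeEnergy lam mu (Λ k) (modeCoeff k v)) := fun k => by
          rw [modeEnergy_smul, modeEnergy_smul, inv_pow]; ring
        simp only [e2]
        rw [← Finset.mul_sum, ← mul_assoc, mul_inv_cancel₀ hpi, one_mul]
        have e3 : ∀ S' : Finset (Fin 2 → ℤ), S' ⊆ S → ∑ k ∈ S, (1 - if k ∈ S' then 1 else 0) * t k
            ≤ ∑' k, t k - ∑ k ∈ S', t k := by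
          intro S' hS'
          simp only [sub_mul, one_mul, Finset.sum_sub_distrib, ite_mul, zero_mul,
            Finset.sum_ite_mem, Finset.inter_eq_right.2 hS']
          gcongr
          exact hs.sum_le_tsum S fun k _ => ht0 k
        calc |∑ k ∈ S, ε k ^ 2 * modeEnergy lam mu (Λ k) (modeCoeff k v)|
            ≤ ∑ k ∈ S, |ε k ^ 2 * modeEnergy lam mu (Λ k) (modeCoeff k v)| :=
              Finset.abs_sum_le_sum_abs _ _
          _ ≤ ∑ k ∈ S, (|lam| + |mu|) * ((1 - if k ∈ freqBox p.1 then 1 else 0) * t k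
                + (1 - if k ∈ freqBox p.2 then 1 else 0) * t k) := by
              refine Finset.sum_le_sum fun k _ => ?_
              have h1 := abs_modeEnergy_le lam mu (Λ k) (modeCoeff k v)
              rw [abs_mul, abs_of_nonneg (sq_nonneg (ε k))]
              have h2 : 0 ≤ (|lam| + |mu|) * t k := mul_nonneg (by positivity) (ht0 k)
              have h3 : |modeEnergy lam mu (Λ k) (modeCoeff k v)| ≤ (|lam| + |mu|) * t k := h1
              simp only [ε]
              split_ifs <;> norm_num <;> linarith
          _ ≤ _ := by
              rw [← Finset.mul_sum, Finset.sum_add_distrib]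
              gcongr
              · exact e3 _ Finset.subset_union_left
              · exact e3 _ Finset.subset_union_right
      · intro k hk
        rw [Finset.mem_union] at hk ⊢
        exact hk.imp (neg_mem_freqBox k) (neg_mem_freqBox k)
      · intro k j
        simp only [ε, PiLp.smul_apply, ha, neg_mem_freqBox_iff, Complex.real_smul, map_mul,
          Complex.conj_ofReal]
    have hlim : Tendsto (fun N => ∑' k, t k - ∑ k ∈ freqBox N, t k) atTop (𝓝 0) := by
      have := (hs.hasSum.comp tendsto_freqBox).const_sub (∑' k, t k)
      rwa [sub_self] at this
    refine squeeze_zero_norm hbound ?_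
    rw [← prod_atTop_atTop_eq]
    have := ((hlim.comp tendsto_fst).add (hlim.comp (tendsto_snd (f := atTop)))).const_mul
      (|lam| + |mu|)
    simpa using this
  · have e : ∀ N, energy w n δ lam mu (fourierTruncation v N)
        = ∑ k ∈ freqBox N, modeEnergy lam mu (Λ k) (modeCoeff k v) := by
      intro N
      rw [fourierTruncation, hw.energy_trigField n hδ lam mu neg_mem_freqBox ha]
      simp only [a, modeEnergy_smul]
      rw [← Finset.mul_sum, inv_pow, ← mul_assoc, mul_inv_cancel₀ hpi, one_mul]
    simp only [e]
    exact hsum.hasSum.comp tendsto_freqBox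

theorem IsKernel.nonlocalVNormSq_le {w : ℝ → ℝ} (hw : IsKernel w) (n : Plane) {δ : ℝ}
    (hδ : 0 < δ) (lam mu : ℝ) {v : L2} (hv : modeCoeff 0 v = 0)
    (hs : Summable fun k => ‖nonlocalSymbol w n δ k‖ ^ 2 * ‖modeCoeff k v‖ ^ 2) :
    nonlocalVNormSq w n δ lam mu v ≤ ENNReal.ofReal (∑' k, (‖modeCoeff k v‖ ^ 2
      + (|lam| + |mu|) * (‖nonlocalSymbol w n δ k‖ ^ 2 * ‖modeCoeff k v‖ ^ 2))) := by
  refine (iInf₂_le _ (hw.hasEnergy_of_summable n hδ lam mu hv hs)).trans ?_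
  refine ENNReal.ofReal_le_ofReal ?_
  have h := hasSum_sq_norm_modeCoeff v
  have hsum : Summable fun k => modeEnergy lam mu (nonlocalSymbol w n δ k) (modeCoeff k v) :=
    Summable.of_norm_bounded (hs.mul_left (|lam| + |mu|)) fun k => abs_modeEnergy_le _ _ _ _
  rw [h.summable.tsum_add (hs.mul_left _), h.tsum_eq]
  gcongr
  · exact hs.mul_left _
  · exact (le_abs_self _).trans (abs_modeEnergy_le _ _ _ _)

/-! ### Membership in the energy spaces in Fourier variables -/

theorem HasEnergy.modeCoeff_zero {w : ℝ → ℝ} {n : Plane} {δ lam mu : ℝ} {u : L2} {e : ℝ}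
    (h : HasEnergy w n δ lam mu u e) : modeCoeff 0 u = 0 := by
  obtain ⟨φ, hφ, hlim, -, -⟩ := h
  have hle : ∀ᶠ k in atTop, ENNReal.ofReal ‖modeCoeff 0 u‖
      ≤ eLpNorm (fun x => φ k x - u x) 2 (volume.restrict cell) := by
    filter_upwards [hlim.eventually_lt_const (u := ⊤) (by simp)] with k hk
    have hd : MemLp (fun x => φ k x - u x) 2 (volume.restrict cell) :=
      ⟨(hφ k).smooth.continuous.aestronglyMeasurable.sub (Lp.aestronglyMeasurable u), hk⟩
    have hm : MemLp (φ k) 2 (volume.restrict cell) := by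
      have := hd.add (Lp.memLp u)
      refine this.ae_eq (ae_of_all _ fun x => ?_)
      simp
    have h0 : modeCoeff 0 (hm.toLp _) = 0 := by
      refine modeCoeff_zero_eq_zero ?_
      rw [← (hφ k).mean_zero]
      exact integral_congr_ae hm.coeFn_toLp
    have h1 : ‖modeCoeff 0 (hm.toLp _ - u)‖ ≤ ‖hm.toLp _ - u‖ := by
      refine le_of_sq_le_sq ?_ (norm_nonneg _)
      exact le_hasSum (hasSum_sq_norm_modeCoeff _) 0 fun _ _ => by positivity
    rw [map_sub, h0, zero_sub, norm_neg] at h1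
    refine (ENNReal.ofReal_le_ofReal h1).trans (le_of_eq ?_)
    rw [ofReal_norm, Lp.enorm_def]
    refine eLpNorm_congr_ae ?_
    filter_upwards [Lp.coeFn_sub (hm.toLp _) u, hm.coeFn_toLp] with x h1 h2
    rw [h1, Pi.sub_apply, h2]
  have h := ge_of_tendsto hlim hle
  rw [nonpos_iff_eq_zero, ENNReal.ofReal_eq_zero] at h
  exact norm_le_zero_iff.1 h

/-- The Fourier coefficients of a weak gradient. -/
theorem IsWeakGrad.modeCoeff_eq {u : L2} {A : Fin 2 → L2} (h : IsWeakGrad u A) (k : Fin 2 → ℤ)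
    (i j : Fin 2) : modeCoeff k (A i) j = localSymbol k i * modeCoeff k u j := by
  have hre : ∀ c : ℂ, (conj (modeCoeff k u j) * (c * localSymbol k i)).re
      = -(conj (modeCoeff k (A i) j) * c).re := by
    intro c
    have h1 := h (trigPoly {k} fun _ => c) (contDiff_trigPoly _ _) (isPeriodic_trigPoly _ _) i
    simp only [fderiv_trigPoly_single] at h1
    have hcoord : ∀ (v : L2) (d : (Fin 2 → ℤ) → ℂ), (∫ x in cell, trigPoly {k} d x • v x) j
        = 2 * π * (conj (modeCoeff k v j) * d k).re := by
      intro v d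
      rw [eval_integral_piLp]
      · exact integral_trigPoly_mul (memLp_coord v j) k d
      · exact fun i => integrable_trigPoly_mul (memLp_coord v i) {k} d
    have h2 := congrArg (fun z : Plane => z j) h1
    simp only [PiLp.neg_apply, hcoord] at h2
    have hpi := Real.pi_pos
    rw [← mul_neg] at h2
    exact mul_left_cancel₀ (by positivity) h2
  have hre1 := hre 1
  have hreI := hre Complex.I
  simp only [localSymbol, Complex.mul_re, Complex.mul_im, Complex.conj_re, Complex.conj_im,
    Complex.I_re, Complex.I_im, Complex.one_re, Complex.one_im, Complex.intCast_re,
    Complex.intCast_im] at hre1 hreI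
  apply Complex.ext <;>
  · simp only [localSymbol, Complex.mul_re, Complex.mul_im, Complex.I_re, Complex.I_im,
      Complex.intCast_re, Complex.intCast_im]
    linarith

theorem summable_of_mem_localV {u : L2} (hu : u ∈ localV) :
    Summable fun k => ‖freq k‖ ^ 2 * ‖modeCoeff k u‖ ^ 2 := by
  obtain ⟨-, A, hA⟩ := hu
  have h := (hasSum_sq_norm_modeCoeff (A 0)).summable.add
    (hasSum_sq_norm_modeCoeff (A 1)).summable
  refine h.congr fun k => ?_
  have hi : ∀ i, ‖modeCoeff k (A i)‖ ^ 2 = ‖localSymbol k i‖ ^ 2 * ‖modeCoeff k u‖ ^ 2 := by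
    intro i
    rw [EuclideanSpace.norm_sq_eq, EuclideanSpace.norm_sq_eq, Finset.mul_sum]
    refine Finset.sum_congr rfl fun j _ => ?_
    rw [hA.modeCoeff_eq, norm_mul, mul_pow]
  rw [hi, hi, ← norm_localSymbol, EuclideanSpace.norm_sq_eq (localSymbol k), Fin.sum_univ_two]
  ring

/-! ### Fourier modes of weak solutions -/

theorem intervalIntegrable_of_memLp {E : Type*} [NormedAddCommGroup E] {T : ℝ} (hT : 0 ≤ T)
    {f : ℝ → E} (hf : MemLp f 2 (volume.restrict (Set.Ioo 0 T))) :
    IntervalIntegrable f volume 0 T :=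
  (intervalIntegrable_iff_integrableOn_Ioo_of_le hT).2 (hf.integrable one_le_two)

theorem sq_integral_norm_le {E : Type*} [NormedAddCommGroup E] {T : ℝ} (hT : 0 < T) {f : ℝ → E}
    (hf : MemLp f 2 (volume.restrict (Set.Ioo 0 T))) :
    (∫ s in (0 : ℝ)..T, ‖f s‖) ^ 2 ≤ T * ∫ s in Set.Ioo 0 T, ‖f s‖ ^ 2 := by
  have e : ∫ s in (0 : ℝ)..T, ‖f s‖ = ∫ s in Set.Ioo 0 T, ‖f s‖ := by
    rw [intervalIntegral.integral_of_le hT.le, integral_Ioc_eq_integral_Ioo]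
  rw [e]
  set m := ∫ s in Set.Ioo 0 T, ‖f s‖
  have hi1 : Integrable (fun s => ‖f s‖) (volume.restrict (Set.Ioo 0 T)) :=
    (hf.integrable one_le_two).norm
  have hi2 : Integrable (fun s => ‖f s‖ ^ 2) (volume.restrict (Set.Ioo 0 T)) :=
    (memLp_two_iff_integrable_sq_norm hf.1).1 hf
  -- the variance of `‖f‖` over the interval is nonnegative
  have h : 0 ≤ ∫ s in Set.Ioo 0 T, (‖f s‖ - m / T) ^ 2 := integral_nonneg fun s => sq_nonneg _
  have e2 : ∀ s, (‖f s‖ - m / T) ^ 2 = ‖f s‖ ^ 2 - 2 * (m / T) * ‖f s‖ + (m / T) ^ 2 :=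
    fun s => by ring
  simp only [e2] at h
  have hi3 : Integrable (fun s => ‖f s‖ ^ 2 - 2 * (m / T) * ‖f s‖)
      (volume.restrict (Set.Ioo 0 T)) := hi2.sub (hi1.const_mul _)
  rw [integral_add hi3 (integrable_const _),
    integral_sub hi2 (hi1.const_mul _), integral_const_mul] at h
  simp only [integral_const, smul_eq_mul, measureReal_restrict_apply_univ, Real.volume_real_Ioo,
    sub_zero, max_eq_left hT.le] at h
  have e3 : (∫ s in Set.Ioo 0 T, ‖f s‖ ^ 2) - 2 * (m / T) * m + T * (m / T) ^ 2
      = (∫ s in Set.Ioo 0 T, ‖f s‖ ^ 2) - m ^ 2 / T := by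
    field_simp; ring
  rw [e3, sub_nonneg, div_le_iff₀ hT] at h
  linarith

theorem summable_sq_integral_norm_modeCoeff {T : ℝ} (hT : 0 < T) {f : ℝ → L2}
    (hf : MemLp f 2 (volume.restrict (Set.Ioo 0 T))) :
    Summable fun k => (∫ s in (0 : ℝ)..T, ‖modeCoeff k (f s)‖) ^ 2 := by
  have hk : ∀ k, MemLp (fun s => modeCoeff k (f s)) 2 (volume.restrict (Set.Ioo 0 T)) :=
    fun k => (modeCoeff k).comp_memLp' hf
  have hi : ∀ k, Integrable (fun s => ‖modeCoeff k (f s)‖ ^ 2) (volume.restrict (Set.Ioo 0 T)) :=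
    fun k => (memLp_two_iff_integrable_sq_norm (hk k).1).1 (hk k)
  refine Summable.of_nonneg_of_le (fun k => sq_nonneg _) (fun k => sq_integral_norm_le hT (hk k)) ?_
  refine Summable.mul_left T ?_
  refine summable_of_sum_le (c := ∫ s in Set.Ioo 0 T, ‖f s‖ ^ 2)
    (fun k => integral_nonneg fun s => sq_nonneg _) fun S => ?_
  rw [← integral_finsetSum _ fun k _ => hi k]
  refine integral_mono (integrable_finsetSum _ fun k _ => hi k)
    ((memLp_two_iff_integrable_sq_norm hf.1).1 hf) fun s => ?_
  exact sum_le_hasSum S (fun _ _ => by positivity) (hasSum_sq_norm_modeCoeff (f s))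

section WeakSolution

variable {V : Set L2} {normSq : L2 → ℝ≥0∞} {P : (Plane → Plane) → Plane → Plane} {T : ℝ}
  {f : ℝ → L2} {g h : L2} {u u' : ℝ → L2}

theorem IsWeakSolution.initial (hu : IsWeakSolution V normSq P T f g h u u') (hT : 0 ≤ T) :
    u 0 = g := by
  have := hu.deriv 0 ⟨le_rfl, hT⟩
  simpa using this

theorem IsWeakSolution.continuousOn (hu : IsWeakSolution V normSq P T f g h u u') (hT : 0 ≤ T) :
    ContinuousOn u (Set.Icc 0 T) :=
  continuousOn_of_eq_add_primitive hT (intervalIntegrable_of_memLp hT hu.deriv_memLp)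
    fun s hs => by rw [hu.deriv s hs, hu.initial hT]

theorem IsWeakSolution.modeCoeff_eq (hu : IsWeakSolution V normSq P T f g h u u') (hT : 0 ≤ T)
    (k : Fin 2 → ℤ) {t : ℝ} (ht : t ∈ Set.Icc 0 T) :
    modeCoeff k (u t) = modeCoeff k g + ∫ s in (0 : ℝ)..t, modeCoeff k (u' s) := by
  have hi := (intervalIntegrable_of_memLp hT hu.deriv_memLp).mono_set
    (by rw [Set.uIcc_of_le ht.1, Set.uIcc_of_le hT]; exact Set.Icc_subset_Icc_right ht.2 :
      Set.uIcc 0 t ⊆ Set.uIcc 0 T)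
  rw [(modeCoeff k).intervalIntegral_comp_comm hi, ← map_add, ← hu.deriv t ht]

/-- A weak solution of zero mean has a velocity of zero mean. -/
theorem IsWeakSolution.modeCoeff_zero_deriv (hu : IsWeakSolution V normSq P T f g h u u')
    (hT : 0 ≤ T) (h0 : ∀ t ∈ Set.Icc 0 T, modeCoeff 0 (u t) = 0) :
    ∀ᵐ t ∂(volume.restrict (Set.Ioo 0 T)), modeCoeff 0 (u' t) = 0 := by
  have hint : IntervalIntegrable (fun s => modeCoeff 0 (u' s)) volume 0 T :=
    intervalIntegrable_of_memLp hT ((modeCoeff 0).comp_memLp' hu.deriv_memLp)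
  have hprim : ∀ t ∈ Set.Icc 0 T, ∫ s in (0 : ℝ)..t, modeCoeff 0 (u' s) = 0 := by
    intro t ht
    have h1 := hu.modeCoeff_eq hT 0 ht
    have h2 := h0 0 ⟨le_rfl, hT⟩
    rw [hu.initial hT] at h2
    rwa [h0 t ht, h2, zero_add, eq_comm] at h1
  rw [ae_restrict_iff' measurableSet_Ioo]
  filter_upwards [hint.ae_hasDerivAt_integral] with t ht hmem
  have hd := ht (by rw [Set.uIcc_of_le hT]; exact Set.Ioo_subset_Icc_self hmem) 0 Set.left_mem_uIcc
  refine hd.unique ((hasDerivAt_const t (0 : ModeSpace)).congr_of_eventuallyEq ?_)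
  filter_upwards [Ioo_mem_nhds hmem.1 hmem.2] with s hs
  exact hprim s (Set.Ioo_subset_Icc_self hs)

/-- Testing the weak equation with the fields `Re(a exp(i k · x))` shows that the `k`-th Fourier
coefficient of a weak solution solves the equation of the mode `k`. -/
theorem IsWeakSolution.exists_isModeSolution {G : (Plane → ℝ) → Plane → Plane}
    {D : (Plane → Plane) → Plane → ℝ} {Λ : (Fin 2 → ℤ) → ModeSpace} (hΛ : HasSymbol G D Λ)
    {lam mu : ℝ} (hT : 0 < T) (hf : MemLp f 2 (volume.restrict (Set.Ioo 0 T)))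
    (hu : IsWeakSolution V normSq (navier G D lam mu) T f g h u u') {k : Fin 2 → ℤ} (hk : k ≠ 0) :
    ∃ y, IsModeSolution (navierSymbol lam mu (Λ k)) (fun t => modeCoeff k (f t)) T
        (fun t => modeCoeff k (u t)) y ∧ y 0 = modeCoeff k h ∧
      ∀ᵐ t ∂(volume.restrict (Set.Ioo 0 T)), modeCoeff k (u' t) = y t := by
  set M := navierSymbol lam mu (Λ k)
  set F : ℝ → ModeSpace := fun t => modeCoeff k (f t)
  set x : ℝ → ModeSpace := fun t => modeCoeff k (u t)
  set y : ℝ → ModeSpace := fun t => modeCoeff k h + ∫ s in (0 : ℝ)..t, (F s - M (x s))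
  have hF : IntervalIntegrable F volume 0 T :=
    intervalIntegrable_of_memLp hT.le ((modeCoeff k).comp_memLp' hf)
  have hx : ContinuousOn x (Set.Icc 0 T) :=
    (modeCoeff k).continuous.comp_continuousOn (hu.continuousOn hT.le)
  have hacc : IntervalIntegrable (fun s => F s - M (x s)) volume 0 T := by
    refine hF.sub (ContinuousOn.intervalIntegrable ?_)
    rw [Set.uIcc_of_le hT.le]
    exact M.continuous.comp_continuousOn hx
  have hy0 : y 0 = modeCoeff k h := by simp [y]
  have hae : ∀ᵐ t ∂(volume.restrict (Set.Ioo 0 T)), modeCoeff k (u' t) = y t := by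
    set b := stdOrthonormalBasis ℝ ModeSpace
    have hb : ∀ i, ∀ᵐ t ∂(volume.restrict (Set.Ioo 0 T)),
        inner ℝ (modeCoeff k (u' t)) (b i) = inner ℝ (y t) (b i) := by
      intro i
      have htest : IsTestField (trigField {k} (Pi.single k (b i))) :=
        isTestField_trigField (Pi.single_eq_of_ne hk.symm _)
      filter_upwards [hu.equation _ htest, ae_restrict_mem measurableSet_Ioo] with t ht hmem
      rw [hΛ.navier_trigField] at ht
      simp only [pairing_trigField, Pi.single_eq_same, ← mul_sub] at ht
      rw [intervalIntegral.integral_const_mul, ← mul_add] at ht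
      have h1 := mul_left_cancel₀ (by positivity : 2 * π ≠ 0) ht
      have h2 : ∀ s, inner ℝ (modeCoeff k (f s)) (b i) - inner ℝ (modeCoeff k (u s)) (M (b i))
          = innerSL ℝ (b i) (F s - M (x s)) := fun s => by
        rw [innerSL_apply_apply, real_inner_comm (F s - M (x s)), inner_sub_left,
          navierSymbol_symmetric]
      rw [h1, funext h2, (innerSL ℝ (b i)).intervalIntegral_comp_comm (hacc.mono_set (by
        rw [Set.uIcc_of_le hmem.1.le, Set.uIcc_of_le hT.le]
        exact Set.Icc_subset_Icc_right hmem.2.le)), innerSL_apply_apply,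
        real_inner_comm (∫ s in (0 : ℝ)..t, (F s - M (x s))) (b i), ← inner_add_left]
    filter_upwards [ae_all_iff.2 hb] with t ht
    refine InnerProductSpace.ext_inner_right_basis b.toBasis fun i => ?_
    rw [b.coe_toBasis]
    exact ht i
  refine ⟨y, ⟨hx, hF, fun t ht => ?_, fun t _ => by rw [hy0]⟩, hy0, hae⟩
  simp only [x]
  rw [hu.modeCoeff_eq hT.le k ht, hu.initial hT.le]
  congr 1
  apply intervalIntegral.integral_congr_ae
  have h1 : ∀ᵐ s ∂(volume.restrict (Set.Ioc 0 T)), modeCoeff k (u' s) = y s := by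
    rwa [← Measure.restrict_congr_set (Ioo_ae_eq_Ioc)]
  rw [ae_restrict_iff' measurableSet_Ioc] at h1
  filter_upwards [h1] with s hs hmem
  rw [Set.uIoc_of_le ht.1] at hmem
  exact hs ⟨hmem.1, hmem.2.trans ht.2⟩

end WeakSolution

/-! ### Uniform bounds and the local limit of each mode -/

/-- The right-hand side of the energy estimate of a mode of frequency `|k|² = κ` with initial
position `a`, initial velocity `b` and forcing of time integral `K`. It does not involve `δ`: the
factor `32` bounds the nonlocal symbol by the local one. -/
def modeBound (lam mu κ : ℝ) (a b : ModeSpace) (K : ℝ) : ℝ :=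
  2 * (‖b‖ ^ 2 + (|mu| + |lam + mu|) * (32 * (κ * ‖a‖ ^ 2))) + 4 * K ^ 2

theorem IsModeSolution.norm_sq_le {lam mu κ T : ℝ} (hmu : 0 < mu) (hlam : 0 < lam + 2 * mu)
    {Λ : ModeSpace} (hΛ : ‖Λ‖ ^ 2 ≤ 32 * κ) {F x y : ℝ → ModeSpace}
    (h : IsModeSolution (navierSymbol lam mu Λ) F T x y) {t : ℝ} (ht : t ∈ Set.Icc 0 T) {R : ℝ}
    (hR : modeBound lam mu κ (x 0) (y 0) (∫ s in (0 : ℝ)..T, ‖F s‖) ≤ R) :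
    ‖y t‖ ^ 2 ≤ R ∧ ‖Λ‖ ^ 2 * ‖x t‖ ^ 2 ≤ R / min mu (lam + 2 * mu) ∧
      ‖x t‖ ^ 2 ≤ 2 * ‖x 0‖ ^ 2 + 2 * T ^ 2 * R := by
  have hc : 0 < min mu (lam + 2 * mu) := lt_min hmu hlam
  have hcoer := navierSymbol_coercive lam mu Λ
  have hpos : ∀ a, 0 ≤ inner ℝ (navierSymbol lam mu Λ a) a := fun a =>
    (by positivity : 0 ≤ min mu (lam + 2 * mu) * (‖Λ‖ ^ 2 * ‖a‖ ^ 2)).trans (hcoer a)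
  have hsym := navierSymbol_symmetric lam mu Λ
  have h0 : 2 * (‖y 0‖ ^ 2 + inner ℝ (navierSymbol lam mu Λ (x 0)) (x 0))
      + 4 * (∫ s in (0 : ℝ)..T, ‖F s‖) ^ 2 ≤ R := by
    refine le_trans ?_ hR
    rw [modeBound]
    gcongr
    refine (inner_navierSymbol_self_le lam mu Λ (x 0)).trans ?_
    have := mul_le_mul_of_nonneg_right hΛ (sq_nonneg ‖x 0‖)
    exact mul_le_mul_of_nonneg_left (by linarith) (by positivity)
  have h1 := (h.energy_le hsym hpos ht).trans h0
  refine ⟨by linarith [hpos (x t)], ?_, ?_⟩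
  · rw [le_div_iff₀ hc]
    nlinarith [hcoer (x t), sq_nonneg ‖y t‖]
  · refine (h.norm_sq_position_le hsym hpos ht).trans ?_
    gcongr

theorem norm_sub_sq_le {E : Type*} [SeminormedAddCommGroup E] (a b : E) :
    ‖a - b‖ ^ 2 ≤ 2 * ‖a‖ ^ 2 + 2 * ‖b‖ ^ 2 := by
  have h := norm_sub_le a b
  nlinarith [sq_nonneg (‖a‖ - ‖b‖), norm_nonneg (a - b)]

/-- The distance of a nonlocal mode from the local one is dominated uniformly in `δ`. -/
theorem IsModeSolution.norm_sub_sq_le_bound {lam mu T : ℝ} (hmu : 0 < mu) (hlam : 0 < lam + 2 * mu)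
    {Λ₀ Λ : ModeSpace} (hΛ : ‖Λ‖ ^ 2 ≤ 32 * ‖Λ₀‖ ^ 2) {F x₀ y₀ x y : ℝ → ModeSpace}
    (h : IsModeSolution (navierSymbol lam mu Λ) F T x y)
    (h₀ : IsModeSolution (navierSymbol lam mu Λ₀) F T x₀ y₀)
    (hx : x 0 = x₀ 0) (hy : y 0 = y₀ 0) {t : ℝ} (ht : t ∈ Set.Icc 0 T) {R : ℝ}
    (hR : modeBound lam mu (‖Λ₀‖ ^ 2) (x₀ 0) (y₀ 0) (∫ s in (0 : ℝ)..T, ‖F s‖) = R) :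
    ‖x t - x₀ t‖ ^ 2 + ‖Λ‖ ^ 2 * ‖x t - x₀ t‖ ^ 2 + ‖y t - y₀ t‖ ^ 2
      ≤ 8 * ‖x₀ 0‖ ^ 2 + (8 * T ^ 2 + 66 / min mu (lam + 2 * mu) + 4) * R := by
  obtain ⟨a1, a2, a3⟩ := h.norm_sq_le hmu hlam hΛ ht (R := R) (by rw [hx, hy, hR])
  obtain ⟨b1, b2, b3⟩ := h₀.norm_sq_le hmu hlam (κ := ‖Λ₀‖ ^ 2)
    (by linarith [sq_nonneg ‖Λ₀‖]) ht hR.le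
  rw [hx] at a3
  have e1 := norm_sub_sq_le (x t) (x₀ t)
  have e2 := norm_sub_sq_le (y t) (y₀ t)
  have e3 := mul_le_mul_of_nonneg_right hΛ (sq_nonneg ‖x₀ t‖)
  have e4 := mul_le_mul_of_nonneg_left e1 (sq_nonneg ‖Λ‖)
  have e5 : (8 * T ^ 2 + 66 / min mu (lam + 2 * mu) + 4) * R
      = 8 * T ^ 2 * R + 66 * (R / min mu (lam + 2 * mu)) + 4 * R := by ring
  rw [e5]
  nlinarith

/-- The distance of a nonlocal mode from the local one is controlled by the distance of their
operators, by the energy estimate for the difference of the modes. -/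
theorem IsModeSolution.norm_sub_sq_le_of_operator {lam mu T : ℝ} (hT : 0 ≤ T) (hmu : 0 < mu)
    (hlam : 0 < lam + 2 * mu) {Λ₀ Λ : ModeSpace} {F x₀ y₀ x y : ℝ → ModeSpace}
    (h : IsModeSolution (navierSymbol lam mu Λ) F T x y)
    (h₀ : IsModeSolution (navierSymbol lam mu Λ₀) F T x₀ y₀)
    (hx : x 0 = x₀ 0) (hy : y 0 = y₀ 0) {t : ℝ} (ht : t ∈ Set.Icc 0 T) {R : ℝ}
    (hR : modeBound lam mu (‖Λ₀‖ ^ 2) (x₀ 0) (y₀ 0) (∫ s in (0 : ℝ)..T, ‖F s‖) = R) :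
    ‖x t - x₀ t‖ ^ 2 + ‖Λ‖ ^ 2 * ‖x t - x₀ t‖ ^ 2 + ‖y t - y₀ t‖ ^ 2
      ≤ (2 * T ^ 2 + 1 / min mu (lam + 2 * mu) + 1) *
        (4 * (T ^ 2 * (‖navierSymbol lam mu Λ₀ - navierSymbol lam mu Λ‖ ^ 2 *
          (2 * ‖x₀ 0‖ ^ 2 + 2 * T ^ 2 * R)))) := by
  have hd := h.sub hT h₀
  set N := ‖navierSymbol lam mu Λ₀ - navierSymbol lam mu Λ‖
  set X := 2 * ‖x₀ 0‖ ^ 2 + 2 * T ^ 2 * R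
  set r := 4 * (T ^ 2 * (N ^ 2 * X))
  have hX : ∀ s ∈ Set.Icc 0 T, ‖x₀ s‖ ^ 2 ≤ X := fun s hs =>
    (h₀.norm_sq_le hmu hlam (κ := ‖Λ₀‖ ^ 2) (by linarith [sq_nonneg ‖Λ₀‖]) hs hR.le).2.2
  have hX0 : 0 ≤ X := (sq_nonneg _).trans (hX 0 ⟨le_rfl, hT⟩)
  have hK : (∫ s in (0 : ℝ)..T,
      ‖(navierSymbol lam mu Λ₀ - navierSymbol lam mu Λ) (x₀ s)‖) ^ 2 ≤ T ^ 2 * (N ^ 2 * X) := by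
    have h1 : ∀ s ∈ Set.uIoc 0 T,
        ‖‖(navierSymbol lam mu Λ₀ - navierSymbol lam mu Λ) (x₀ s)‖‖ ≤ N * √X := by
      intro s hs
      rw [Set.uIoc_of_le hT] at hs
      rw [norm_norm]
      refine (ContinuousLinearMap.le_opNorm _ _).trans ?_
      gcongr
      exact Real.le_sqrt_of_sq_le (hX s ⟨hs.1.le, hs.2⟩)
    have h2 := intervalIntegral.norm_integral_le_of_norm_le_const h1
    rw [sub_zero, abs_of_nonneg hT] at h2
    calc _ = ‖∫ s in (0 : ℝ)..T,
            ‖(navierSymbol lam mu Λ₀ - navierSymbol lam mu Λ) (x₀ s)‖‖ ^ 2 := by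
          rw [Real.norm_eq_abs, sq_abs]
      _ ≤ (N * √X * T) ^ 2 := by gcongr
      _ = T ^ 2 * (N ^ 2 * √X ^ 2) := by ring
      _ = _ := by rw [Real.sq_sqrt hX0]
  obtain ⟨c1, c2, c3⟩ := hd.norm_sq_le hmu hlam (κ := ‖Λ‖ ^ 2) (R := r)
    (by linarith [sq_nonneg ‖Λ‖]) ht (by
      rw [modeBound, hx, hy, sub_self, sub_self, norm_zero]
      simp only [r]
      linarith)
  simp only [hx, sub_self, norm_zero] at c3
  have e : (2 * T ^ 2 + 1 / min mu (lam + 2 * mu) + 1) * r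
      = 2 * T ^ 2 * r + r / min mu (lam + 2 * mu) + r := by ring
  rw [e]
  linarith

/-! ### Summation over the modes -/

theorem enorm_sq_eq_ofReal_tsum (v : L2) :
    ‖v‖ₑ ^ 2 = ENNReal.ofReal (∑' k, ‖modeCoeff k v‖ ^ 2) := by
  rw [(hasSum_sq_norm_modeCoeff v).tsum_eq, ENNReal.ofReal_pow (norm_nonneg v), ofReal_norm]

/-- A bound for each mode, summable over the modes, bounds the nonlocal energy norm. -/
theorem IsKernel.nonlocalVNormSq_le_of_modeCoeff_le {w : ℝ → ℝ} (hw : IsKernel w) (n : Plane)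
    {δ : ℝ} (hδ : 0 < δ) (lam mu : ℝ) {v : L2} {A : (Fin 2 → ℤ) → ℝ} (hA : Summable A)
    (hv : modeCoeff 0 v = 0)
    (h : ∀ k, ‖modeCoeff k v‖ ^ 2 + ‖nonlocalSymbol w n δ k‖ ^ 2 * ‖modeCoeff k v‖ ^ 2 ≤ A k) :
    nonlocalVNormSq w n δ lam mu v ≤ ENNReal.ofReal ((1 + (|lam| + |mu|)) * ∑' k, A k) := by
  have hs : Summable fun k => ‖nonlocalSymbol w n δ k‖ ^ 2 * ‖modeCoeff k v‖ ^ 2 :=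
    Summable.of_nonneg_of_le (fun k => by positivity)
      (fun k => by linarith [h k, sq_nonneg ‖modeCoeff k v‖]) hA
  refine (hw.nonlocalVNormSq_le n hδ lam mu hv hs).trans (ENNReal.ofReal_le_ofReal ?_)
  rw [← tsum_mul_left]
  refine Summable.tsum_le_tsum (fun k => ?_)
    ((hasSum_sq_norm_modeCoeff v).summable.add (hs.mul_left _)) (hA.mul_left _)
  have h1 : 0 ≤ |lam| + |mu| := by positivity
  nlinarith [h k, mul_le_mul_of_nonneg_left (h k) h1,
    mul_nonneg h1 (sq_nonneg ‖modeCoeff k v‖),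
    mul_nonneg (sq_nonneg ‖nonlocalSymbol w n δ k‖) (sq_nonneg ‖modeCoeff k v‖)]

theorem enorm_sq_le_of_modeCoeff_le {v : L2} {A : (Fin 2 → ℤ) → ℝ} (hA : Summable A)
    (h : ∀ k, ‖modeCoeff k v‖ ^ 2 ≤ A k) : ‖v‖ₑ ^ 2 ≤ ENNReal.ofReal (∑' k, A k) := by
  rw [enorm_sq_eq_ofReal_tsum]
  exact ENNReal.ofReal_le_ofReal
    (Summable.tsum_le_tsum h (hasSum_sq_norm_modeCoeff v).summable hA)

end NonlocalNavier

end

open NonlocalNavier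

theorem mainTheorem12
    (w : ℝ → ℝ) (hw : NonlocalNavier.IsKernel w)
    (n : NonlocalNavier.Plane) (hn : ‖n‖ = 1)
    (lam mu : ℝ) (hmu : 0 < mu) (hlam : 0 < lam + 2 * mu)
    (T : ℝ) (hT : 0 < T)
    (g h : NonlocalNavier.L2) (hg : g ∈ NonlocalNavier.localV)
    (hh : ∫ x in NonlocalNavier.cell, h x = 0)
    (f : ℝ → NonlocalNavier.L2) (hf : MemLp f 2 (volume.restrict (Set.Ioo 0 T)))
    (u u' : ℝ → NonlocalNavier.L2)
    (hu : NonlocalNavier.IsWeakSolution NonlocalNavier.localV NonlocalNavier.localVNormSq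
      (NonlocalNavier.localNavier lam mu) T f g h u u')
    (uδ uδ' : ℝ → ℝ → NonlocalNavier.L2)
    (huδ : ∀ᶠ δ in 𝓝[>] (0 : ℝ),
      NonlocalNavier.IsWeakSolution (NonlocalNavier.nonlocalV w n δ lam mu)
        (NonlocalNavier.nonlocalVNormSq w n δ lam mu)
        (NonlocalNavier.nonlocalNavier w n δ lam mu) T f g h (uδ δ) (uδ' δ)) :
    Tendsto (fun δ => ∫⁻ t in Set.Ioo 0 T,
        NonlocalNavier.nonlocalVNormSq w n δ lam mu (uδ δ t - u t)) (𝓝[>] 0) (𝓝 0) ∧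
    Tendsto (fun δ => ∫⁻ t in Set.Ioo 0 T,
        (‖uδ δ t - u t‖ₑ ^ 2 + ‖uδ' δ t - u' t‖ₑ ^ 2)) (𝓝[>] 0) (𝓝 0) := by
  set c := min mu (lam + 2 * mu)
  have hc : 0 < c := lt_min hmu hlam
  set R : (Fin 2 → ℤ) → ℝ := fun k => modeBound lam mu (‖localSymbol k‖ ^ 2) (modeCoeff k g)
    (modeCoeff k h) (∫ s in (0 : ℝ)..T, ‖modeCoeff k (f s)‖) with hRdef
  set B : (Fin 2 → ℤ) → ℝ := fun k =>
    8 * ‖modeCoeff k g‖ ^ 2 + (8 * T ^ 2 + 66 / c + 4) * R k with hBdef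
  set ε : ℝ → (Fin 2 → ℤ) → ℝ := fun δ k => (2 * T ^ 2 + 1 / c + 1) *
    (4 * (T ^ 2 * (‖navierSymbol lam mu (localSymbol k)
      - navierSymbol lam mu (nonlocalSymbol w n δ k)‖ ^ 2 *
        (2 * ‖modeCoeff k g‖ ^ 2 + 2 * T ^ 2 * R k)))) with hεdef
  set A : ℝ → (Fin 2 → ℤ) → ℝ := fun δ k => min (B k) (ε δ k) with hAdef
  have hR0 : ∀ k, 0 ≤ R k := fun k => by simp only [hRdef, modeBound]; positivity
  have hB0 : ∀ k, 0 ≤ B k := fun k => by have := hR0 k; simp only [hBdef]; positivity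
  have hε0 : ∀ δ k, 0 ≤ ε δ k := fun δ k => by have := hR0 k; simp only [hεdef]; positivity
  have hA0 : ∀ δ k, 0 ≤ A δ k := fun δ k => le_min (hB0 k) (hε0 δ k)
  have hgs := (hasSum_sq_norm_modeCoeff g).summable
  have hRs : Summable R := by
    have h1 := summable_of_mem_localV hg
    simp only [← norm_localSymbol] at h1
    exact (((hasSum_sq_norm_modeCoeff h).summable.add
      ((h1.mul_left 32).mul_left (|mu| + |lam + mu|))).mul_left 2).add
        ((summable_sq_integral_norm_modeCoeff hT hf).mul_left 4)
  have hBs : Summable B := (hgs.mul_left 8).add (hRs.mul_left _)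
  have hAs : ∀ δ, Summable (A δ) := fun δ =>
    Summable.of_nonneg_of_le (hA0 δ) (fun k => min_le_left _ _) hBs
  -- dominated convergence over the frequencies
  have hlim : Tendsto (fun δ => ∑' k, A δ k) (𝓝[>] 0) (𝓝 0) := by
    have hεlim : ∀ k, Tendsto (fun δ => ε δ k) (𝓝[>] 0) (𝓝 0) := by
      intro k
      have h1 := ((continuous_navierSymbol lam mu).tendsto _).comp (hw.tendsto_nonlocalSymbol hn k)
      have h2 := ((h1.const_sub (navierSymbol lam mu (localSymbol k))).norm.pow 2)
      rw [sub_self, norm_zero, zero_pow two_ne_zero] at h2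
      have h3 := (((h2.mul_const (2 * ‖modeCoeff k g‖ ^ 2 + 2 * T ^ 2 * R k)).const_mul
        (T ^ 2)).const_mul 4).const_mul (2 * T ^ 2 + 1 / c + 1)
      simp only [zero_mul, mul_zero] at h3
      exact h3
    have h := tendsto_tsum_of_dominated_convergence (𝓕 := 𝓝[>] (0 : ℝ)) (f := A)
      (g := fun _ => (0 : ℝ)) hBs
      (fun k => squeeze_zero (fun δ => hA0 δ k) (fun δ => min_le_right _ _) (hεlim k))
      (Eventually.of_forall fun δ k => by
        rw [Real.norm_of_nonneg (hA0 δ k)]; exact min_le_left _ _)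
    rwa [tsum_zero] at h
  have hu0 : ∀ t ∈ Set.Icc 0 T, modeCoeff 0 (u t) = 0 := fun t ht =>
    modeCoeff_zero_eq_zero (hu.mem t ht).1
  choose y₀ hy₀ hy₀0 hy₀ae using fun k : {k : Fin 2 → ℤ // k ≠ 0} =>
    hu.exists_isModeSolution hasSymbol_local hT hf k.2
  -- the distance of all modes, at almost every time
  have hmodes : ∀ᶠ δ in 𝓝[>] (0 : ℝ), 0 < δ ∧
      ∀ᵐ t ∂(volume.restrict (Set.Ioo 0 T)), modeCoeff 0 (uδ δ t - u t) = 0 ∧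
        ∀ k, ‖modeCoeff k (uδ δ t - u t)‖ ^ 2
          + ‖nonlocalSymbol w n δ k‖ ^ 2 * ‖modeCoeff k (uδ δ t - u t)‖ ^ 2
          + ‖modeCoeff k (uδ' δ t - u' t)‖ ^ 2 ≤ A δ k := by
    filter_upwards [huδ, self_mem_nhdsWithin] with δ hδu hδ
    have hδ : 0 < δ := hδ
    refine ⟨hδ, ?_⟩
    have huδ0 : ∀ t ∈ Set.Icc 0 T, modeCoeff 0 (uδ δ t) = 0 := fun t ht => by
      obtain ⟨e, he⟩ := hδu.mem t ht
      exact he.modeCoeff_zero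
    choose y hy hy0 hyae using fun k : {k : Fin 2 → ℤ // k ≠ 0} =>
      hδu.exists_isModeSolution (hw.hasSymbol_nonlocal n hδ) hT hf k.2
    filter_upwards [ae_all_iff.2 hy₀ae, ae_all_iff.2 hyae, hu.modeCoeff_zero_deriv hT.le hu0,
      hδu.modeCoeff_zero_deriv hT.le huδ0, ae_restrict_mem measurableSet_Ioo]
      with t h1 h2 h3 h4 ht
    have ht' := Set.Ioo_subset_Icc_self ht
    have hz : modeCoeff 0 (uδ δ t - u t) = 0 := by
      rw [map_sub, huδ0 t ht', hu0 t ht', sub_self]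
    refine ⟨hz, fun k => ?_⟩
    by_cases hk : k = 0
    · rw [hk, hz, map_sub, h3, h4]
      simpa using hA0 δ 0
    · have e1 := h1 ⟨k, hk⟩
      have e2 := h2 ⟨k, hk⟩
      have s0 := hy₀ ⟨k, hk⟩
      have s1 := hy ⟨k, hk⟩
      have i0 : modeCoeff k (uδ δ 0) = modeCoeff k (u 0) := by
        rw [hu.initial hT.le, hδu.initial hT.le]
      have i1 : y ⟨k, hk⟩ 0 = y₀ ⟨k, hk⟩ 0 := by rw [hy0, hy₀0]
      have hRk : modeBound lam mu (‖localSymbol k‖ ^ 2) (modeCoeff k (u 0)) (y₀ ⟨k, hk⟩ 0)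
          (∫ s in (0 : ℝ)..T, ‖modeCoeff k (f s)‖) = R k := by
        rw [hu.initial hT.le, hy₀0]
      have hΛ : ‖nonlocalSymbol w n δ k‖ ^ 2 ≤ 32 * ‖localSymbol k‖ ^ 2 := by
        rw [norm_localSymbol]; exact hw.norm_sq_nonlocalSymbol_le n hδ k
      have b1 := s1.norm_sub_sq_le_bound hmu hlam hΛ s0 i0 i1 ht' hRk
      have b2 := s1.norm_sub_sq_le_of_operator hT.le hmu hlam s0 i0 i1 ht' hRk
      rw [hu.initial hT.le] at b1 b2
      rw [map_sub, map_sub, e1, e2]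
      exact le_min b1 b2
  have hvol : volume (Set.Ioo 0 T) = ENNReal.ofReal T := by rw [Real.volume_Ioo, sub_zero]
  constructor
  · have hbound : Tendsto (fun δ => ENNReal.ofReal ((1 + (|lam| + |mu|)) * ∑' k, A δ k)
        * ENNReal.ofReal T) (𝓝[>] 0) (𝓝 0) := by
      have h1 := ENNReal.Tendsto.mul_const (b := ENNReal.ofReal T)
        (ENNReal.tendsto_ofReal (hlim.const_mul (1 + (|lam| + |mu|))))
        (Or.inr ENNReal.ofReal_ne_top)
      simpa using h1
    refine tendsto_of_tendsto_of_tendsto_of_le_of_le' tendsto_const_nhds hbound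
      (Eventually.of_forall fun δ => zero_le) ?_
    filter_upwards [hmodes] with δ ⟨hδ, hm⟩
    rw [← hvol, ← setLIntegral_const]
    refine lintegral_mono_ae ?_
    filter_upwards [hm] with t ⟨hz, hk⟩
    exact hw.nonlocalVNormSq_le_of_modeCoeff_le n hδ lam mu (hAs δ) hz fun k =>
      (le_add_of_nonneg_right (sq_nonneg _)).trans (hk k)
  · have hbound : Tendsto (fun δ => (ENNReal.ofReal (∑' k, A δ k) + ENNReal.ofReal (∑' k, A δ k))
        * ENNReal.ofReal T) (𝓝[>] 0) (𝓝 0) := by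
      have h1 := ENNReal.Tendsto.mul_const (b := ENNReal.ofReal T)
        ((ENNReal.tendsto_ofReal hlim).add (ENNReal.tendsto_ofReal hlim))
        (Or.inr ENNReal.ofReal_ne_top)
      simpa using h1
    refine tendsto_of_tendsto_of_tendsto_of_le_of_le' tendsto_const_nhds hbound
      (Eventually.of_forall fun δ => zero_le) ?_
    filter_upwards [hmodes] with δ ⟨hδ, hm⟩
    rw [← hvol, ← setLIntegral_const]
    refine lintegral_mono_ae ?_
    filter_upwards [hm] with t ⟨_, hk⟩
    have hprod : ∀ k, 0 ≤ ‖nonlocalSymbol w n δ k‖ ^ 2 * ‖modeCoeff k (uδ δ t - u t)‖ ^ 2 :=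
      fun k => by positivity
    refine add_le_add (enorm_sq_le_of_modeCoeff_le (hAs δ) fun k => ?_)
      (enorm_sq_le_of_modeCoeff_le (hAs δ) fun k => ?_)
    · linarith [hk k, hprod k, sq_nonneg ‖modeCoeff k (uδ' δ t - u' t)‖]
    · linarith [hk k, hprod k, sq_nonneg ‖modeCoeff k (uδ δ t - u t)‖]
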